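/- Two servers in series process updates for a monitor. Server 1 executes step 1 and takes independent exponential times of rate $\mu_1>0$; it generates a fresh (age zero) update immediately upon completing the previous one and passes the completed one to server 2. Server 2 executes step 2 and takes independent exponential times of rate $\mu_2>0$, independent of those of server 1, and delivers to the monitor. In the M/M/1/1 model server 2 blocks and discards every update that arrives from server 1 while it is busy. Let $\rho=\mu_1/\mu_2$, and let $\alpha$ be a real number. The age at the monitor at time $t$ is $t$ minus the generation time of the freshest update it has received by then, and the average age is the limit of the expected age as $t\to\infty$. Then, from every initial state (server 2 idle or busy, with ages $0\le x_1\le x_2\le x_0$ of the updates at server 1, server 2 and the monitor), the average age of the M/M/1/1 model exists and equals $$\Delta_{\mathrm{M/M/1/1}}(\mu_2,\rho)=\frac{2}{\mu_2}\Bigl(1+\frac1\rho\Bigr).$$ This is twice the average age $\Delta_{\mathrm{M/M/1}^*}(\mu_2,\rho)$ of the M/M/1* line network with preemption in service at both servers, in which server 1 always works on a current sample of the source, so that updates have age zero when they reach server 2 (at the times of a Poisson process of rate $\mu_1$), and in which an arrival at server 2 preempts and discards the update in service there. Moreover the discrete state $q(t)\in\{0,1\}$ of the M/M/1/1 model (server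 2 idle or busy) has exactly one stationary distribution $\pi$, and its power-weighted processor activity $\bar N(\rho)=\rho^\alpha\sum_q\pi_q n_{q,1}+\sum_q\pi_q n_{q,2}$, where $n_{q,i}$ is the number of processors that execute step $i$ in state $q$ (so $n_{0,1}=n_{1,1}=1$, $n_{0,2}=0$, $n_{1,2}=1$), is $$\bar N(\rho)=\rho^\alpha+\frac{\rho}{1+\rho}.$$ -/

import Mathlib

open MeasureTheory ProbabilityTheory Filter Topology

/-! Two servers in series: server 1 executes step 1 and passes its updates on to server 2, which
executes step 2 and delivers to the monitor. Sample paths are described through two real sequences: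
`x i` is the time that the `i`-th execution of step 1 takes (`i = 0, 1, …`, one after the other, server
1 never rests; `x 0` is what remains at time `0`), and `s k` is the time that step 2 of update `k`
takes. Update `0` is the one found at server 2 at time `0`, if there is one; update `k + 1` is the
one that leaves server 1 when execution number `k` ends. -/

namespace Tandem

/-- The discrete state: `0` if server 2 is idle, `1` if it is busy. -/
abbrev ServerState := Fin 2

/-- The situation at time `0`: the discrete state, the age at the monitor, and the ages of the
updates at servers 1 and 2 (the last one means nothing if server 2 is idle). -/
structure Start where
  state : ServerState
  monitorAge : ℝ
  age₁ : ℝ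
  age₂ : ℝ
  age₁_nonneg : 0 ≤ age₁
  age₁_le_age₂ : age₁ ≤ age₂
  age₂_le_monitorAge : age₂ ≤ monitorAge

/-- The time at which update `k` reaches server 2 (time `0` for update `0`). -/
def arrivalTime (x : ℕ → ℝ) (k : ℕ) : ℝ := ∑ i ∈ Finset.range k, x i

/-- Generate-at-will with zero wait: the time at which update `k` was generated. Server 1 generates a
fresh update at the moment it completes the previous one. -/
def genTime (I : Start) (x : ℕ → ℝ) : ℕ → ℝ
  | 0 => -I.age₂
  | 1 => -I.age₁
  | k + 2 => arrivalTime x (k + 1)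

/-- The age at the monitor at time `t`: the time elapsed since the generation of the freshest update
received so far, the monitor having held an update of age `a₀` at time `0`. Here `gen k` is the time at
which update `k` was generated, and `delivered k` says that it has reached the monitor by time `t`. -/
noncomputable def monitorAge (a₀ : ℝ) (gen : ℕ → ℝ) (delivered : ℕ → Prop) (t : ℝ) : ℝ :=
  t - sSup (insert (-a₀) (gen '' {k | delivered k}))

/-! ### M/M/1/1: server 2 blocks and discards while it is busy -/

/-- The time at which server 2 is finished with whatever it accepted among the updates `0, …, k`. -/
noncomputable def freeTime (q₀ : ServerState) (x s : ℕ → ℝ) : ℕ → ℝ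
  | 0 => if q₀ = 1 then s 0 else 0
  | k + 1 =>
    if freeTime q₀ x s k ≤ arrivalTime x (k + 1) then arrivalTime x (k + 1) + s (k + 1)
    else freeTime q₀ x s k

/-- Update `k + 1` is accepted if server 2 is idle when it arrives, and discarded otherwise. -/
def Accepted (q₀ : ServerState) (x s : ℕ → ℝ) : ℕ → Prop
  | 0 => q₀ = 1
  | k + 1 => freeTime q₀ x s k ≤ arrivalTime x (k + 1)

open Classical in
/-- The discrete state `q(t)`. -/
noncomputable def stateMM11 (q₀ : ServerState) (x s : ℕ → ℝ) (t : ℝ) : ServerState :=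
  if ∃ k, Accepted q₀ x s k ∧ arrivalTime x k ≤ t ∧ t < arrivalTime x k + s k then 1 else 0

/-- The age at the monitor in the M/M/1/1 model. -/
noncomputable def ageMM11 (I : Start) (x s : ℕ → ℝ) (t : ℝ) : ℝ :=
  monitorAge I.monitorAge (genTime I x)
    (fun k => Accepted I.state x s k ∧ arrivalTime x k + s k ≤ t) t

/-! ### M/M/1*: the line network with preemption in service -/

/-- Update `k` enters service as soon as it reaches server 2. -/
def Enters (q₀ : ServerState) : ℕ → Prop
  | 0 => q₀ = 1
  | _ + 1 => True

/-- Server 1 always works on a current sample of the source (a fresher sample preempts the one in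
service), so that an update has age zero when it is handed over to server 2. -/
def lineGenTime (I : Start) (x : ℕ → ℝ) : ℕ → ℝ
  | 0 => -I.age₂
  | k + 1 => arrivalTime x (k + 1)

/-- The age at the monitor in the M/M/1* line network: an update reaches the monitor if its service at
server 2 ends before the next update arrives there and preempts it. -/
noncomputable def ageMM1Star (I : Start) (x s : ℕ → ℝ) (t : ℝ) : ℝ :=
  monitorAge I.monitorAge (lineGenTime I x)
    (fun k => Enters I.state k ∧ arrivalTime x k + s k ≤ arrivalTime x (k + 1) ∧
      arrivalTime x k + s k ≤ t) t

/-! ### Averages -/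

variable {Ω : Type*} [MeasurableSpace Ω]

/-- The execution times are independent, exponential of rate `μ₁` for step 1 and `μ₂` for step 2. -/
structure ExpServices (P : Measure Ω) (μ₁ μ₂ : ℝ) (X S : ℕ → Ω → ℝ) : Prop where
  law_step₁ : ∀ i, HasLaw (X i) (expMeasure μ₁) P
  law_step₂ : ∀ k, HasLaw (S k) (expMeasure μ₂) P
  indep : iIndepFun (Sum.elim X S) P

/-- `a` is the average age of the age process `Δ`: the limit of `E[Δ(t)]` as `t → ∞`. -/
def IsAverageAge (P : Measure Ω) (Δ : ℝ → Ω → ℝ) (a : ℝ) : Prop :=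
  (∀ t, 0 ≤ t → Integrable (Δ t) P) ∧ Tendsto (fun t => ∫ ω, Δ t ω ∂P) atTop (𝓝 a)

/-- The transition probabilities `P(q(t) = j | q(0) = i)` of the discrete state of M/M/1/1. -/
noncomputable def transProb (P : Measure Ω) (X S : ℕ → Ω → ℝ) (t : ℝ) (i j : ServerState) : ℝ :=
  P.real {ω | stateMM11 i (fun n => X n ω) (fun n => S n ω) t = j}

/-- `π` is a stationary distribution for the transition probabilities `p t i j`. -/
def IsStationary (p : ℝ → ServerState → ServerState → ℝ) (π : ServerState → ℝ) : Prop :=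
  (∀ q, 0 ≤ π q) ∧ ∑ q, π q = 1 ∧ ∀ t, 0 ≤ t → ∀ j, ∑ i, π i * p t i j = π j

/-- The number `n_{q,1}` of processors executing step 1 in state `q`: server 1 never rests. -/
def numStep₁ (_q : ServerState) : ℝ := 1

/-- The number `n_{q,2}` of processors executing step 2 in state `q`. -/
def numStep₂ (q : ServerState) : ℝ := if q = 1 then 1 else 0

/-- The power-weighted processor activity `ρ^α N̄₁ + N̄₂`, where `N̄ᵢ = ∑ π_q n_{q,i}`. -/
noncomputable def activity (α ρ : ℝ) (π : ServerState → ℝ) : ℝ :=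
  ρ ^ α * (∑ q, π q * numStep₁ q) + ∑ q, π q * numStep₂ q

end Tandem

/-! The age at time `t` is at least `a` exactly when no update generated after `u = t - a` has been
delivered by `t`. For `0 < a ≤ t` this event has a probability `κ a` (`freshTail`) that depends
neither on `t` nor on the start. By loss of memory, the first completion of step 1 after `u` takes
an exponential time of rate `μ₁`. At that moment server 2 is busy whatever its past: with the
arriving update or, under blocking, possibly with an older one, whose residual service is again
exponential of rate `μ₂`. So the system starts afresh (`Refresh`), and `κ` is the tail of that
waiting time plus an independent time `D` until the first fresh delivery. Formally, the probability
solves a renewal equation in `u` that the constant `κ a` solves too, and bounded solutions are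
unique (`renewal_unique`, `FreshFamily.measure_eq_freshTail`).

The mean of `D` comes from a first-step analysis (`lintegral_defective_renewal`). With probability
`θ = μ₁ / (μ₁ + μ₂)` server 1 finishes before server 2, nothing fresh has been delivered, and the
situation repeats; otherwise `D` is an explicit `τ`. Hence `E D = c + μ₁ / (μ₁ + μ₂) ^ 2 + θ * E D`,
where `c` is the integral of `τ` over the second case. Blocking has `τ = x 0 + s 1` and `E D = 1 /
μ₁ + 2 / μ₂`; preemption has `τ = s 0` and `E D = 1 / μ₂`. Adding the wait `1 / μ₁` gives total
masses of `κ` in the ratio two to one. Since the age at `t` is at most `t` plus its initial value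
`a₀`, the expected age differs from the integral of `κ` over `(0, t]` by at most `κ t * a₀`, which
tends to zero (`isAverageAge_of_tail`).

The discrete state restarts in the same way at the first arrival. Its probability of being busy
therefore solves a renewal equation with an explicit solution (`measure_busyAt`), from which the
stationary distribution is read off. -/

/-! ### Integrals against the exponential law -/

open Set in
lemma lintegral_expMeasure {r : ℝ} (f : ℝ → ENNReal) :
    ∫⁻ y, f y ∂(expMeasure r) =
      ∫⁻ y in Ioi 0, ENNReal.ofReal (r * Real.exp (-(r * y))) * f y := by
  have h : expMeasure r = volume.withDensity (exponentialPDF r) := rfl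
  have hm : Measurable (exponentialPDF r) := by
    unfold exponentialPDF; fun_prop
  rw [h, lintegral_withDensity_eq_lintegral_mul_non_measurable _ hm
    (ae_of_all _ fun x => by simp [exponentialPDF]),
    ← setLIntegral_eq_of_support_subset (s := Ici 0), restrict_Ioi_eq_restrict_Ici]
  · refine setLIntegral_congr_fun measurableSet_Ici fun y hy => ?_
    simp [exponentialPDF_of_nonneg hy]
  · intro y hy
    by_contra hy'
    exact hy (by simp [exponentialPDF_of_neg (not_le.1 hy')])

lemma expMeasure_Iic {r : ℝ} (hr : 0 < r) {t : ℝ} (ht : 0 ≤ t) :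
    expMeasure r (Set.Iic t) = ENNReal.ofReal (1 - Real.exp (-(r * t))) := by
  have := isProbabilityMeasure_expMeasure hr
  rw [← ofReal_cdf, cdf_expMeasure_eq hr, if_pos ht]

lemma expMeasure_Ioi {r : ℝ} (hr : 0 < r) {t : ℝ} (ht : 0 ≤ t) :
    expMeasure r (Set.Ioi t) = ENNReal.ofReal (Real.exp (-(r * t))) := by
  have := isProbabilityMeasure_expMeasure hr
  rw [← Set.compl_Iic, prob_compl_eq_one_sub measurableSet_Iic, expMeasure_Iic hr ht,
    ← ENNReal.ofReal_one, ← ENNReal.ofReal_sub]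
  · simp
  · simp only [sub_nonneg, Real.exp_le_one_iff]
    nlinarith

lemma ae_expMeasure_pos {r : ℝ} (hr : 0 < r) : ∀ᵐ y ∂(expMeasure r), 0 < y := by
  rw [ae_iff]
  have := expMeasure_Iic hr le_rfl
  simpa [Set.Iic] using this

/-- Loss of memory of the exponential law. -/
lemma setLIntegral_Ioi_expMeasure {r : ℝ} {y : ℝ} (hy : 0 ≤ y) (G : ℝ → ENNReal) :
    ∫⁻ v in Set.Ioi y, G (v - y) ∂(expMeasure r) =
      ENNReal.ofReal (Real.exp (-(r * y))) * ∫⁻ v, G v ∂(expMeasure r) := by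
  rw [← lintegral_indicator measurableSet_Ioi, lintegral_expMeasure, lintegral_expMeasure,
    ← lintegral_const_mul' _ _ ENNReal.ofReal_ne_top,
    ← lintegral_indicator measurableSet_Ioi, ← lintegral_indicator measurableSet_Ioi,
    ← lintegral_add_right_eq_self _ y]
  refine lintegral_congr fun v => ?_
  by_cases hv : 0 < v
  · rw [Set.indicator_of_mem (by simp; linarith), Set.indicator_of_mem (by simpa using hv),
      Set.indicator_of_mem (by simpa using hv), ← mul_assoc, ← ENNReal.ofReal_mul (by positivity)]
    simp only [add_sub_cancel_right]
    congr 2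
    rw [mul_left_comm, ← Real.exp_add]; congr 2; ring
  · rw [Set.indicator_of_notMem (a := v) (by simpa using hv)]
    by_cases hv' : 0 < v + y
    · rw [Set.indicator_of_mem (by simpa using hv'), Set.indicator_of_notMem (by simpa using hv)]
      simp
    · rw [Set.indicator_of_notMem (by simpa using hv')]

lemma lintegral_Ioi_ofReal_exp {c : ℝ} (hc : 0 < c) :
    ∫⁻ y in Set.Ioi (0 : ℝ), ENNReal.ofReal (Real.exp (-(c * y))) = ENNReal.ofReal (1 / c) := by
  have h := integral_exp_mul_Ioi (a := -c) (by linarith) 0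
  have hi : IntegrableOn (fun y : ℝ => Real.exp (-c * y)) (Set.Ioi 0) :=
    exp_neg_integrableOn_Ioi 0 hc
  simp only [← neg_mul]
  rw [← ofReal_integral_eq_lintegral_ofReal hi (ae_of_all _ fun y => (Real.exp_pos _).le), h]
  simp

lemma lintegral_Ioi_ofReal_mul_exp {c : ℝ} (hc : 0 < c) :
    ∫⁻ y in Set.Ioi (0 : ℝ), ENNReal.ofReal (y * Real.exp (-(c * y))) =
      ENNReal.ofReal (1 / c ^ 2) := by
  have h := Real.integral_rpow_mul_exp_neg_mul_Ioi (a := 2) (by norm_num) hc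
  have h1 : ∀ y : ℝ, y ^ ((2 : ℝ) - 1) = y := fun y => by norm_num
  simp only [h1, Real.Gamma_two, mul_one] at h
  -- The Bochner integral of a non-integrable function is `0`, whereas the value in `h` is positive.
  have hi : IntegrableOn (fun y : ℝ => y * Real.exp (-(c * y))) (Set.Ioi 0) := by
    by_contra hi
    rw [integral_undef hi] at h
    have : (0 : ℝ) < (1 / c) ^ (2 : ℝ) := by positivity
    linarith
  rw [← ofReal_integral_eq_lintegral_ofReal hi, h]
  · norm_num
  · refine (ae_restrict_iff' measurableSet_Ioi).2 (ae_of_all _ fun y hy => ?_)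
    have : (0 : ℝ) < y := hy
    simp only [Pi.zero_apply]; positivity

lemma lintegral_expMeasure_ofReal_exp {r c : ℝ} (hr : 0 < r) (hc : 0 ≤ c) :
    ∫⁻ y, ENNReal.ofReal (Real.exp (-(c * y))) ∂(expMeasure r) =
      ENNReal.ofReal (r / (r + c)) := by
  rw [lintegral_expMeasure]
  have : ∀ y : ℝ, ENNReal.ofReal (r * Real.exp (-(r * y))) * ENNReal.ofReal (Real.exp (-(c * y)))
      = ENNReal.ofReal r * ENNReal.ofReal (Real.exp (-((r + c) * y))) := fun y => by
    rw [← ENNReal.ofReal_mul (by positivity), ← ENNReal.ofReal_mul hr.le, mul_assoc,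
      ← Real.exp_add]
    congr 3; ring
  simp only [this]
  rw [lintegral_const_mul' _ _ ENNReal.ofReal_ne_top, lintegral_Ioi_ofReal_exp (by linarith),
    ← ENNReal.ofReal_mul hr.le]
  congr 1; ring

lemma lintegral_expMeasure_ofReal_mul_exp {r c : ℝ} (hr : 0 < r) (hc : 0 ≤ c) :
    ∫⁻ y, ENNReal.ofReal (Real.exp (-(c * y))) * ENNReal.ofReal y ∂(expMeasure r) =
      ENNReal.ofReal (r / (r + c) ^ 2) := by
  rw [lintegral_expMeasure]
  have : ∀ y : ℝ, ENNReal.ofReal (r * Real.exp (-(r * y))) *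
      (ENNReal.ofReal (Real.exp (-(c * y))) * ENNReal.ofReal y)
      = ENNReal.ofReal r * ENNReal.ofReal (y * Real.exp (-((r + c) * y))) := fun y => by
    rw [← ENNReal.ofReal_mul (by positivity), ← ENNReal.ofReal_mul (by positivity),
      ← ENNReal.ofReal_mul hr.le]
    congr 1
    rw [show -((r + c) * y) = -(r * y) + -(c * y) by ring, Real.exp_add]
    ring
  simp only [this]
  rw [lintegral_const_mul' _ _ ENNReal.ofReal_ne_top, lintegral_Ioi_ofReal_mul_exp (by linarith),
    ← ENNReal.ofReal_mul hr.le]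
  congr 1; ring

lemma lintegral_expMeasure_ofReal {r : ℝ} (hr : 0 < r) :
    ∫⁻ y, ENNReal.ofReal y ∂(expMeasure r) = ENNReal.ofReal (1 / r) := by
  have := lintegral_expMeasure_ofReal_mul_exp hr le_rfl
  simp only [zero_mul, neg_zero, Real.exp_zero, ENNReal.ofReal_one, one_mul, add_zero] at this
  rw [this]
  congr 1
  field_simp

/-! ### Renewal equations -/

/-- A renewal equation has at most one bounded solution. -/
lemma renewal_unique {r : ℝ} (hr : 0 < r) {φ ψ g : ℝ → ENNReal}
    (hφ1 : ∀ t, 0 ≤ t → φ t ≤ 1) (hψ1 : ∀ t, 0 ≤ t → ψ t ≤ 1)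
    (hφ : ∀ t, 0 ≤ t → φ t = g t + ∫⁻ y in Set.Iic t, φ (t - y) ∂(expMeasure r))
    (hψ : ∀ t, 0 ≤ t → ψ t = g t + ∫⁻ y in Set.Iic t, ψ (t - y) ∂(expMeasure r))
    {t : ℝ} (ht : 0 ≤ t) : φ t = ψ t := by
  wlog key : ∀ φ ψ : ℝ → ENNReal, (∀ t, 0 ≤ t → φ t ≤ 1) →
      (∀ t, 0 ≤ t → φ t = g t + ∫⁻ y in Set.Iic t, φ (t - y) ∂(expMeasure r)) →
      (∀ t, 0 ≤ t → ψ t = g t + ∫⁻ y in Set.Iic t, ψ (t - y) ∂(expMeasure r)) →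
      φ t ≤ ψ t
  · refine this hr hφ1 hψ1 hφ hψ ht fun φ ψ hφ1 hφ hψ => ?_
    have := isProbabilityMeasure_expMeasure hr
    set θ := expMeasure r (Set.Iic t) with hθ
    have hθ1 : θ < 1 := by
      rw [hθ, expMeasure_Iic hr ht, ENNReal.ofReal_lt_one]
      linarith [Real.exp_pos (-(r * t))]
    -- On `[0, t]` the convolution is a contraction with factor `θ`, the probability of a renewal by
    -- time `t`. The one-sided form with an additive error avoids subtraction in `ENNReal`.
    have main : ∀ n : ℕ, ∀ t' ∈ Set.Icc 0 t, φ t' ≤ ψ t' + θ ^ n := by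
      intro n
      induction n with
      | zero => intro t' ht'; simpa using (hφ1 t' ht'.1).trans le_add_self
      | succ n ih =>
        intro t' ht'
        rw [hφ t' ht'.1, hψ t' ht'.1, add_assoc]
        gcongr
        calc ∫⁻ y in Set.Iic t', φ (t' - y) ∂(expMeasure r)
            ≤ ∫⁻ y in Set.Iic t', (ψ (t' - y) + θ ^ n) ∂(expMeasure r) := by
              refine lintegral_mono_ae ?_
              filter_upwards [ae_restrict_of_ae (ae_expMeasure_pos hr),
                ae_restrict_mem measurableSet_Iic] with y hy hy'
              refine ih _ ⟨?_, ?_⟩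
              · simpa using hy'
              · linarith [ht'.2]
          _ = ∫⁻ y in Set.Iic t', ψ (t' - y) ∂(expMeasure r) +
                θ ^ n * expMeasure r (Set.Iic t') := by
              rw [lintegral_add_right _ measurable_const, setLIntegral_const]
          _ ≤ _ := by
              rw [pow_succ]
              gcongr
              exact measure_mono (Set.Iic_subset_Iic.2 ht'.2)
    have hlim : Tendsto (fun n : ℕ => ψ t + θ ^ n) atTop (𝓝 (ψ t + 0)) :=
      (ENNReal.tendsto_pow_atTop_nhds_zero_of_lt_one hθ1).const_add _
    rw [add_zero] at hlim
    exact ge_of_tendsto' hlim fun n => main n t ⟨ht, le_rfl⟩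
  exact le_antisymm (key φ ψ hφ1 hφ hψ) (key ψ φ hψ1 hψ hφ)

lemma setLIntegral_sub_right (f : ℝ → ENNReal) {S : Set ℝ} (hS : MeasurableSet S) (y : ℝ) :
    ∫⁻ t in S, f (t - y) = ∫⁻ t in (fun t => t + y) ⁻¹' S, f t := by
  rw [← lintegral_indicator hS, ← lintegral_indicator (hS.preimage (by fun_prop)),
    ← lintegral_add_right_eq_self _ y]
  refine lintegral_congr fun t => ?_
  simp only [Set.indicator, add_sub_cancel_right]
  rfl

lemma setLIntegral_Ioc_neg {n : ℝ → ENNReal} (hneg : ∀ t, t < 0 → n t = 1) (y : ℝ) :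
    ∫⁻ t in Set.Ioc (-y) 0, n t = ENNReal.ofReal y := by
  rw [← restrict_Ioo_eq_restrict_Ioc,
    setLIntegral_congr_fun measurableSet_Ioo fun t ht => hneg t ht.2]
  simp

/-- Delaying by `y` prepends a stretch of length `y` on which the function is `1`. This is the
source of the mean delay in the integrated renewal equations. -/
lemma setLIntegral_Ioi_sub {n : ℝ → ENNReal} (hneg : ∀ t, t < 0 → n t = 1) {y : ℝ} (hy : 0 ≤ y) :
    ∫⁻ t in Set.Ioi 0, n (t - y) = ENNReal.ofReal y + ∫⁻ t in Set.Ioi 0, n t := by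
  rw [setLIntegral_sub_right n measurableSet_Ioi, ← setLIntegral_Ioc_neg hneg y,
    ← lintegral_union measurableSet_Ioi]
  · congr 2
    ext t
    simp only [Set.mem_preimage, Set.mem_Ioi, Set.mem_union, Set.mem_Ioc]
    constructor
    · intro h
      rcases le_or_gt t 0 with h' | h'
      · left; constructor <;> linarith
      · right; exact h'
    · rintro (h | h) <;> linarith
  · exact Set.disjoint_left.2 fun t ht ht' => not_lt.2 ht.2 ht'

/-- Total mass of the solution of a defective renewal equation that is `1` on the negative
half-line. -/
lemma lintegral_defective_renewal {r : ℝ} (hr : 0 < r) {n a k : ℝ → ENNReal} (hn : Measurable n)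
    (hk : Measurable k) (hn1 : ∀ t, n t ≤ 1) (hneg : ∀ t, t < 0 → n t = 1)
    (heq : ∀ t, 0 < t → n t = a t + ∫⁻ y, k y * n (t - y) ∂(expMeasure r))
    (hθ : ∫⁻ y, k y ∂(expMeasure r) < 1)
    (ha : ∫⁻ t in Set.Ioi 0, a t ≠ ⊤)
    (hky : ∫⁻ y, k y * ENNReal.ofReal y ∂(expMeasure r) ≠ ⊤) :
    ∫⁻ t in Set.Ioi 0, n t ≠ ⊤ ∧
    ∫⁻ t in Set.Ioi 0, n t = (∫⁻ t in Set.Ioi 0, a t) +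
      (∫⁻ y, k y * ENNReal.ofReal y ∂(expMeasure r)) +
      (∫⁻ y, k y ∂(expMeasure r)) * ∫⁻ t in Set.Ioi 0, n t := by
  have := isProbabilityMeasure_expMeasure hr
  set A := ∫⁻ t in Set.Ioi 0, a t
  set K := ∫⁻ y, k y * ENNReal.ofReal y ∂(expMeasure r)
  set θ := ∫⁻ y, k y ∂(expMeasure r)
  have hconv : Measurable fun p : ℝ × ℝ => k p.2 * n (p.1 - p.2) := by fun_prop
  have hconv' : Measurable fun t : ℝ => ∫⁻ y, k y * n (t - y) ∂(expMeasure r) :=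
    hconv.lintegral_prod_right'
  have swap : ∀ S : Set ℝ, MeasurableSet S → S ⊆ Set.Ioi 0 → ∫⁻ t in S, n t =
      (∫⁻ t in S, a t) + ∫⁻ y, k y * (∫⁻ t in S, n (t - y)) ∂(expMeasure r) := by
    intro S hS hS0
    rw [setLIntegral_congr_fun hS fun t ht => heq t (hS0 ht), lintegral_add_right _ hconv',
      lintegral_lintegral_swap hconv.aemeasurable]
    congr 1
    refine lintegral_congr fun y => ?_
    rw [lintegral_const_mul _ (by fun_prop)]
  -- The identity `I = A + K + θ * I` alone does not exclude `I = ⊤`. Up to a finite horizon the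
  -- integral is finite because `n ≤ 1`, so the corresponding inequality can be solved there,
  -- uniformly in the horizon.
  have bound : ∀ M : ℕ, ∫⁻ t in Set.Ioc 0 (M : ℝ), n t ≤ (1 - θ)⁻¹ * (A + K) := by
    intro M
    set J := ∫⁻ t in Set.Ioc 0 (M : ℝ), n t with hJ
    have hJtop : J ≠ ⊤ := by
      refine ne_top_of_le_ne_top (b := ∫⁻ t in Set.Ioc 0 (M : ℝ), 1) (by simp) ?_
      exact lintegral_mono hn1
    have h1 : J ≤ A + K + θ * J := by
      refine (swap _ measurableSet_Ioc Set.Ioc_subset_Ioi_self).trans_le ?_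
      rw [add_assoc]
      gcongr
      · exact lintegral_mono_set Set.Ioc_subset_Ioi_self
      · calc ∫⁻ y, k y * (∫⁻ t in Set.Ioc 0 (M : ℝ), n (t - y)) ∂(expMeasure r)
            ≤ ∫⁻ y, (k y * ENNReal.ofReal y + k y * J) ∂(expMeasure r) := by
              refine lintegral_mono_ae ?_
              filter_upwards [ae_expMeasure_pos hr] with y hy
              rw [← mul_add]
              gcongr
              rw [setLIntegral_sub_right n measurableSet_Ioc, ← setLIntegral_Ioc_neg hneg y]
              refine (lintegral_mono_set fun t ht => ?_).trans (lintegral_union_le _ _ _)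
              simp only [Set.mem_preimage, Set.mem_Ioc, Set.mem_union] at ht ⊢
              rcases le_or_gt t 0 with h | h
              · left; constructor <;> linarith
              · right; constructor <;> linarith
          _ = K + θ * J := by
              rw [lintegral_add_left (by fun_prop), lintegral_mul_const _ hk]
    have hθ0 : (1 - θ) ≠ 0 := (tsub_pos_of_lt hθ).ne'
    have hθ1 : (1 - θ) ≠ ⊤ := ENNReal.sub_ne_top ENNReal.one_ne_top
    rw [mul_comm, ← div_eq_mul_inv, ENNReal.le_div_iff_mul_le (.inl hθ0) (.inl hθ1), mul_comm,
      ENNReal.sub_mul (fun _ _ => hJtop), one_mul]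
    exact tsub_le_iff_right.2 h1
  refine ⟨?_, ?_⟩
  · have hU : Set.Ioi (0 : ℝ) = ⋃ M : ℕ, Set.Ioc 0 (M : ℝ) := by
      ext t
      simp only [Set.mem_Ioi, Set.mem_iUnion, Set.mem_Ioc]
      exact ⟨fun h => (exists_nat_ge t).imp fun M hM => ⟨h, hM⟩, fun ⟨_, h⟩ => h.1⟩
    refine ne_top_of_le_ne_top (b := (1 - θ)⁻¹ * (A + K)) ?_ ?_
    · refine ENNReal.mul_ne_top (ENNReal.inv_ne_top.2 (tsub_pos_of_lt hθ).ne') ?_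
      exact ENNReal.add_ne_top.2 ⟨ha, hky⟩
    · rw [hU, setLIntegral_iUnion_of_directed]
      · exact iSup_le bound
      · refine directed_of_isDirected_le fun i j hij => Set.Ioc_subset_Ioc_right ?_
        exact_mod_cast hij
  · refine (swap _ measurableSet_Ioi subset_rfl).trans ?_
    rw [add_assoc]
    congr 1
    rw [← lintegral_mul_const _ hk,
      ← lintegral_add_left (by fun_prop)]
    refine lintegral_congr_ae ?_
    filter_upwards [ae_expMeasure_pos hr] with y hy
    rw [← mul_add, setLIntegral_Ioi_sub hneg hy.le]

/-! ### Infinite products of probability measures -/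

/-- The sequence `a, f 0, f 1, …`. -/
def seqCons {α : Type*} (a : α) (f : ℕ → α) : ℕ → α
  | 0 => a
  | k + 1 => f k

lemma measurable_seqCons {α : Type*} [MeasurableSpace α] :
    Measurable fun p : α × (ℕ → α) => seqCons p.1 p.2 := by
  refine measurable_pi_iff.2 fun k => ?_
  cases k with
  | zero => exact measurable_fst
  | succ k => exact (measurable_pi_apply k).comp measurable_snd

lemma infinitePi_map_seqCons {α : Type*} [MeasurableSpace α] (m : Measure α)
    [IsProbabilityMeasure m] :
    (m.prod (Measure.infinitePi fun _ : ℕ => m)).map (fun p => seqCons p.1 p.2) =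
      Measure.infinitePi fun _ : ℕ => m := by
  refine Measure.eq_infinitePi _ fun s t ht => ?_
  obtain ⟨N, hN⟩ := s.exists_nat_subset_range
  classical
  -- Padding with `univ` turns the box into one over an initial segment of `ℕ`, from which
  -- coordinate `0` can be split off.
  set t' : ℕ → Set α := fun i => if i ∈ s then t i else Set.univ with ht'
  have hbox : (s : Set ℕ).pi t = ((Finset.range (N + 1) : Finset ℕ) : Set ℕ).pi t' := by
    ext f
    simp only [Set.mem_pi, ht', Finset.mem_coe]
    constructor
    · intro h i _
      split_ifs with hi
      · exact h i hi
      · trivial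
    · intro h i hi
      have := h i (Finset.range_mono (Nat.le_succ N) (hN hi))
      rwa [if_pos hi] at this
  have hprod : ∏ i ∈ s, m (t i) = ∏ i ∈ Finset.range (N + 1), m (t' i) := by
    rw [← Finset.prod_subset (hN.trans (Finset.range_mono (Nat.le_succ N)))]
    · exact Finset.prod_congr rfl fun i hi => by simp [ht', hi]
    · intro i _ hi
      simp [ht', hi]
  have hm : ∀ i, MeasurableSet (t' i) := fun i => by
    simp only [ht']; split_ifs
    · exact ht i
    · exact .univ
  have hpre : (fun p : α × (ℕ → α) => seqCons p.1 p.2) ⁻¹' (s : Set ℕ).pi t =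
      t' 0 ×ˢ ((Finset.range N : Finset ℕ) : Set ℕ).pi fun i => t' (i + 1) := by
    rw [hbox]
    ext ⟨a, f⟩
    simp only [Set.mem_preimage, Set.mem_pi, Set.mem_prod, Finset.coe_range, Set.mem_Iio]
    constructor
    · exact fun h => ⟨h 0 (by omega), fun i hi => h (i + 1) (by omega)⟩
    · rintro ⟨h0, h⟩ (_ | i) hi
      · exact h0
      · exact h i (by omega)
  rw [Measure.map_apply measurable_seqCons, hpre, Measure.prod_prod, Measure.infinitePi_pi,
    hprod, Finset.prod_range_succ', mul_comm]
  · exact fun i _ => hm _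
  · exact .pi (Finset.countable_toSet s) fun i _ => ht i

lemma lintegral_infinitePi_seqCons {α : Type*} [MeasurableSpace α] (m : Measure α)
    [IsProbabilityMeasure m] {f : (ℕ → α) → ENNReal} (hf : Measurable f) :
    ∫⁻ x, f x ∂(Measure.infinitePi fun _ : ℕ => m) =
      ∫⁻ a, ∫⁻ x, f (seqCons a x) ∂(Measure.infinitePi fun _ : ℕ => m) ∂m := by
  conv_lhs => rw [← infinitePi_map_seqCons m]
  rw [lintegral_map hf measurable_seqCons]
  exact lintegral_prod _ (hf.comp measurable_seqCons).aemeasurable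

/-- A product over a disjoint union of index types is a product of two products. -/
lemma infinitePi_map_sum {ι κ α : Type*} [MeasurableSpace α] (m : ι → Measure α)
    (m' : κ → Measure α) [∀ i, IsProbabilityMeasure (m i)] [∀ i, IsProbabilityMeasure (m' i)] :
    (Measure.infinitePi (Sum.elim m m' : ι ⊕ κ → Measure α)).map
      (fun w => (fun i => w (Sum.inl i), fun k => w (Sum.inr k))) =
      (Measure.infinitePi m).prod (Measure.infinitePi m') := by
  have : ∀ i, IsProbabilityMeasure (Sum.elim m m' i) := by rintro (i | i) <;> simp <;> infer_instance
  have hj : Measurable fun p : (ι → α) × (κ → α) => (Sum.elim p.1 p.2 : ι ⊕ κ → α) := by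
    refine measurable_pi_iff.2 fun k => ?_
    cases k with
    | inl k => exact (measurable_pi_apply k).comp measurable_fst
    | inr k => exact (measurable_pi_apply k).comp measurable_snd
  -- It is easier to push the product forward along the inverse map `Sum.elim`, under which a box
  -- pulls back to a product of two boxes.
  have key : ((Measure.infinitePi m).prod (Measure.infinitePi m')).map
      (fun p => (Sum.elim p.1 p.2 : ι ⊕ κ → α)) = Measure.infinitePi (Sum.elim m m') := by
    refine Measure.eq_infinitePi _ fun s t ht => ?_
    have hpre : (fun p : (ι → α) × (κ → α) => (Sum.elim p.1 p.2 : ι ⊕ κ → α)) ⁻¹'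
        (s : Set (ι ⊕ κ)).pi t = (s.toLeft : Set ι).pi (fun i => t (.inl i)) ×ˢ
          (s.toRight : Set κ).pi (fun i => t (.inr i)) := by
      ext ⟨f, g⟩
      simp [Set.mem_pi]
    rw [Measure.map_apply hj (.pi (Finset.countable_toSet s) fun i _ => ht i), hpre,
      Measure.prod_prod, Measure.infinitePi_pi _ (fun i _ => ht _),
      Measure.infinitePi_pi _ (fun i _ => ht _)]
    conv_rhs => rw [← Finset.toLeft_disjSum_toRight (u := s)]
    rw [Finset.prod_disjSum]
    simp
  rw [← key, Measure.map_map (by fun_prop) hj]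
  exact Measure.map_id

/-! ### The law of a sample path -/

namespace Tandem

/-- The execution times of the two steps along a sample path. -/
abbrev Path := (ℕ → ℝ) × (ℕ → ℝ)

/-- The joint law of the execution times. -/
noncomputable def pathMeasure (μ₁ μ₂ : ℝ) : Measure Path :=
  (Measure.infinitePi fun _ : ℕ => expMeasure μ₁).prod
    (Measure.infinitePi fun _ : ℕ => expMeasure μ₂)

lemma isProbabilityMeasure_pathMeasure {μ₁ μ₂ : ℝ} (hμ₁ : 0 < μ₁) (hμ₂ : 0 < μ₂) :
    IsProbabilityMeasure (pathMeasure μ₁ μ₂) := by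
  have := isProbabilityMeasure_expMeasure hμ₁
  have := isProbabilityMeasure_expMeasure hμ₂
  unfold pathMeasure
  infer_instance

lemma ExpServices.hasLaw_path {Ω : Type*} [MeasurableSpace Ω] {P : Measure Ω} {μ₁ μ₂ : ℝ}
    (hμ₁ : 0 < μ₁) (hμ₂ : 0 < μ₂) {X S : ℕ → Ω → ℝ} (h : ExpServices P μ₁ μ₂ X S) :
    HasLaw (fun ω => ((fun n => X n ω, fun n => S n ω) : Path)) (pathMeasure μ₁ μ₂) P := by
  have := isProbabilityMeasure_expMeasure hμ₁
  have := isProbabilityMeasure_expMeasure hμ₂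
  have hl : ∀ i : ℕ ⊕ ℕ, HasLaw (Sum.elim X S i)
      ((Sum.elim (fun _ => expMeasure μ₁) (fun _ => expMeasure μ₂) : ℕ ⊕ ℕ → Measure ℝ) i) P := by
    rintro (i | i)
    · exact h.law_step₁ i
    · exact h.law_step₂ i
  have : ∀ i : ℕ ⊕ ℕ, IsProbabilityMeasure
      ((Sum.elim (fun _ => expMeasure μ₁) (fun _ => expMeasure μ₂) : ℕ ⊕ ℕ → Measure ℝ) i) := by
    rintro (i | i) <;> simp <;> infer_instance
  have hj := h.indep.hasLaw_infinitePi hl (aemeasurable_pi_iff.2 fun i => (hl i).aemeasurable)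
  refine HasLaw.fun_comp (X := fun ω i => Sum.elim X S i ω)
    (Y := fun w : ℕ ⊕ ℕ → ℝ => ((fun i => w (.inl i), fun k => w (.inr k)) : Path)) ⟨?_, ?_⟩ hj
  · exact Measurable.aemeasurable (by fun_prop)
  · exact infinitePi_map_sum _ _

section Integrals

variable {μ₁ μ₂ : ℝ}

lemma lintegral_pathMeasure (hμ₁ : 0 < μ₁) (hμ₂ : 0 < μ₂) {f : Path → ENNReal}
    (hf : Measurable f) :
    ∫⁻ z, f z ∂(pathMeasure μ₁ μ₂) =
      ∫⁻ y, ∫⁻ v, ∫⁻ z, f (seqCons y z.1, seqCons v z.2) ∂(pathMeasure μ₁ μ₂)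
        ∂(expMeasure μ₂) ∂(expMeasure μ₁) := by
  have := isProbabilityMeasure_expMeasure hμ₁
  have := isProbabilityMeasure_expMeasure hμ₂
  have hc := measurable_seqCons (α := ℝ)
  have h1 : ∀ x : ℕ → ℝ, Measurable fun s => f (x, s) := fun x => by fun_prop
  have h2 : Measurable fun x : ℕ → ℝ => ∫⁻ s, f (x, s)
      ∂(Measure.infinitePi fun _ : ℕ => expMeasure μ₂) := hf.lintegral_prod_right'
  have h3 : ∀ y : ℝ, Measurable fun p : (ℕ → ℝ) × (ℝ × (ℕ → ℝ)) =>
      f (seqCons y p.1, seqCons p.2.1 p.2.2) := fun y =>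
    hf.comp ((hc.comp (measurable_const.prodMk measurable_fst)).prodMk
      (hc.comp measurable_snd))
  unfold pathMeasure
  rw [lintegral_prod _ hf.aemeasurable, lintegral_infinitePi_seqCons _ h2]
  refine lintegral_congr fun y => ?_
  simp_rw [fun x => lintegral_infinitePi_seqCons (expMeasure μ₂) (h1 x)]
  rw [lintegral_lintegral_swap]
  · refine lintegral_congr fun v => ?_
    rw [lintegral_prod]
    exact ((h3 y).comp (measurable_fst.prodMk
      (measurable_const.prodMk measurable_snd))).aemeasurable
  · have : Measurable fun q : ((ℕ → ℝ) × ℝ) × (ℕ → ℝ) => f (seqCons y q.1.1, seqCons q.1.2 q.2) :=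
      (h3 y).comp (measurable_fst.fst.prodMk (measurable_fst.snd.prodMk measurable_snd))
    exact this.lintegral_prod_right'.aemeasurable

lemma lintegral_pathMeasure_cons_right (hμ₁ : 0 < μ₁) (hμ₂ : 0 < μ₂) {f : Path → ENNReal}
    (hf : Measurable f) :
    ∫⁻ v, ∫⁻ z, f (z.1, seqCons v z.2) ∂(pathMeasure μ₁ μ₂) ∂(expMeasure μ₂) =
      ∫⁻ z, f z ∂(pathMeasure μ₁ μ₂) := by
  have := isProbabilityMeasure_expMeasure hμ₁
  have := isProbabilityMeasure_expMeasure hμ₂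
  have hc := measurable_seqCons (α := ℝ)
  have h1 : ∀ x : ℕ → ℝ, Measurable fun s => f (x, s) := fun x => by fun_prop
  have h3 : Measurable fun p : (ℝ × (ℕ → ℝ)) × (ℕ → ℝ) => f (p.1.2, seqCons p.1.1 p.2) :=
    hf.comp (measurable_fst.snd.prodMk (hc.comp (measurable_fst.fst.prodMk measurable_snd)))
  unfold pathMeasure
  rw [lintegral_prod _ hf.aemeasurable]
  simp_rw [fun x => lintegral_infinitePi_seqCons (expMeasure μ₂) (h1 x)]
  have h4 : ∀ v : ℝ, ∫⁻ z, f (z.1, seqCons v z.2) ∂((Measure.infinitePi fun _ : ℕ =>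
      expMeasure μ₁).prod (Measure.infinitePi fun _ : ℕ => expMeasure μ₂)) =
      ∫⁻ x, ∫⁻ s, f (x, seqCons v s) ∂(Measure.infinitePi fun _ : ℕ => expMeasure μ₂)
        ∂(Measure.infinitePi fun _ : ℕ => expMeasure μ₁) := fun v => by
    rw [lintegral_prod]
    exact (h3.comp (f := fun p : (ℕ → ℝ) × (ℕ → ℝ) => ((v, p.1), p.2))
      (by fun_prop)).aemeasurable
  simp_rw [h4]
  exact lintegral_lintegral_swap h3.lintegral_prod_right'.aemeasurable

lemma lintegral_pathMeasure_tail_right (hμ₁ : 0 < μ₁) (hμ₂ : 0 < μ₂) {f : Path → ENNReal}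
    (hf : Measurable f) :
    ∫⁻ z, f (z.1, fun k => z.2 (k + 1)) ∂(pathMeasure μ₁ μ₂) =
      ∫⁻ z, f z ∂(pathMeasure μ₁ μ₂) := by
  have := isProbabilityMeasure_expMeasure hμ₂
  rw [← lintegral_pathMeasure_cons_right hμ₁ hμ₂
    (f := fun z => f (z.1, fun k => z.2 (k + 1))) (hf.comp (by fun_prop))]
  simp [seqCons]

end Integrals

/-! ### Regeneration at the first completion of step 1 -/

/-- `next` describes the execution times left over when the first execution of step 1 ends: they
have the same law as before and depend neither on the length of that execution nor on whether
server 2 was busy all along. -/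
structure Refresh (μ₁ μ₂ : ℝ) (next : Path → Path) : Prop where
  measurable : Measurable next
  lintegral_busy : ∀ H : ℝ × Path → ENNReal, Measurable H →
    ∫⁻ z in {z | z.1 0 < z.2 0}, H (z.1 0, next z) ∂(pathMeasure μ₁ μ₂) =
      ∫⁻ y, expMeasure μ₂ (Set.Ioi y) * ∫⁻ z, H (y, z) ∂(pathMeasure μ₁ μ₂) ∂(expMeasure μ₁)
  lintegral_done : ∀ H : ℝ × Path → ENNReal, Measurable H →
    ∫⁻ z in {z | z.2 0 ≤ z.1 0}, H (z.1 0, next z) ∂(pathMeasure μ₁ μ₂) =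
      ∫⁻ y, expMeasure μ₂ (Set.Iic y) * ∫⁻ z, H (y, z) ∂(pathMeasure μ₁ μ₂) ∂(expMeasure μ₁)

/-- With preemption, the next update starts its service. -/
def nextPreempt (z : Path) : Path := (fun k => z.1 (k + 1), fun k => z.2 (k + 1))

open Classical in
/-- With blocking, a service in progress goes on, and the next update is discarded. -/
noncomputable def nextBlock (z : Path) : Path :=
  (fun k => z.1 (k + 1), seqCons (if z.2 0 ≤ z.1 0 then z.2 1 else z.2 0 - z.1 0)
    fun k => z.2 (k + 2))

lemma measurable_nextPreempt : Measurable nextPreempt := by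
  unfold nextPreempt; fun_prop

lemma measurable_nextBlock : Measurable nextBlock := by
  unfold nextBlock
  refine Measurable.prodMk (by fun_prop) (measurable_seqCons.comp (Measurable.prodMk ?_ ?_))
  · exact Measurable.ite (measurableSet_le (by fun_prop) (by fun_prop)) (by fun_prop) (by fun_prop)
  · fun_prop

lemma measurableSet_busy : MeasurableSet {z : Path | z.1 0 < z.2 0} :=
  measurableSet_lt (by fun_prop) (by fun_prop)

lemma measurableSet_done : MeasurableSet {z : Path | z.2 0 ≤ z.1 0} :=
  measurableSet_le (by fun_prop) (by fun_prop)

section Refresh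

variable {μ₁ μ₂ : ℝ}

lemma setLIntegral_busy (hμ₁ : 0 < μ₁) (hμ₂ : 0 < μ₂) {f : Path → ENNReal} (hf : Measurable f) :
    ∫⁻ z in {z | z.1 0 < z.2 0}, f z ∂(pathMeasure μ₁ μ₂) =
      ∫⁻ y, ∫⁻ v in Set.Ioi y, ∫⁻ z, f (seqCons y z.1, seqCons v z.2) ∂(pathMeasure μ₁ μ₂)
        ∂(expMeasure μ₂) ∂(expMeasure μ₁) := by
  rw [← lintegral_indicator measurableSet_busy,
    lintegral_pathMeasure hμ₁ hμ₂ (hf.indicator measurableSet_busy)]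
  refine lintegral_congr fun y => ?_
  rw [← lintegral_indicator measurableSet_Ioi]
  refine lintegral_congr fun v => ?_
  by_cases h : y < v <;> simp [Set.indicator, seqCons, h]

lemma setLIntegral_done (hμ₁ : 0 < μ₁) (hμ₂ : 0 < μ₂) {f : Path → ENNReal} (hf : Measurable f) :
    ∫⁻ z in {z | z.2 0 ≤ z.1 0}, f z ∂(pathMeasure μ₁ μ₂) =
      ∫⁻ y, ∫⁻ v in Set.Iic y, ∫⁻ z, f (seqCons y z.1, seqCons v z.2) ∂(pathMeasure μ₁ μ₂)
        ∂(expMeasure μ₂) ∂(expMeasure μ₁) := by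
  rw [← lintegral_indicator measurableSet_done,
    lintegral_pathMeasure hμ₁ hμ₂ (hf.indicator measurableSet_done)]
  refine lintegral_congr fun y => ?_
  rw [← lintegral_indicator measurableSet_Iic]
  refine lintegral_congr fun v => ?_
  by_cases h : v ≤ y <;> simp [Set.indicator, seqCons, h]

lemma refresh_nextPreempt (hμ₁ : 0 < μ₁) (hμ₂ : 0 < μ₂) : Refresh μ₁ μ₂ nextPreempt where
  measurable := measurable_nextPreempt
  lintegral_busy H hH := by
    rw [setLIntegral_busy hμ₁ hμ₂ (f := fun z => H (z.1 0, nextPreempt z))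
      (hH.comp (Measurable.prodMk (by fun_prop) measurable_nextPreempt))]
    simp [seqCons, nextPreempt, mul_comm]
  lintegral_done H hH := by
    rw [setLIntegral_done hμ₁ hμ₂ (f := fun z => H (z.1 0, nextPreempt z))
      (hH.comp (Measurable.prodMk (by fun_prop) measurable_nextPreempt))]
    simp [seqCons, nextPreempt, mul_comm]

/-- If server 2 is still busy, its residual service is exponential again by loss of memory. If it is
done, the arriving update brings an independent service time of the same law. -/
lemma refresh_nextBlock (hμ₁ : 0 < μ₁) (hμ₂ : 0 < μ₂) : Refresh μ₁ μ₂ nextBlock where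
  measurable := measurable_nextBlock
  lintegral_busy H hH := by
    rw [setLIntegral_busy hμ₁ hμ₂ (f := fun z => H (z.1 0, nextBlock z))
      (hH.comp (Measurable.prodMk (by fun_prop) measurable_nextBlock))]
    refine lintegral_congr_ae ?_
    filter_upwards [ae_expMeasure_pos hμ₁] with y hy
    have h1 : ∀ v ∈ Set.Ioi y, ∫⁻ z, H ((seqCons y z.1) 0,
        nextBlock (seqCons y z.1, seqCons v z.2)) ∂(pathMeasure μ₁ μ₂) =
        ∫⁻ z, H (y, (z.1, seqCons (v - y) z.2)) ∂(pathMeasure μ₁ μ₂) := by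
      intro v hv
      -- The arriving update is discarded, so its service time is dropped from the sequence and
      -- replaced by the residual `v - y`.
      rw [← lintegral_pathMeasure_tail_right hμ₁ hμ₂
        (f := fun z => H (y, (z.1, seqCons (v - y) z.2)))]
      · simp [seqCons, nextBlock, not_le.2 (Set.mem_Ioi.1 hv)]
      · exact hH.comp (measurable_const.prodMk (measurable_fst.prodMk
          (measurable_seqCons.comp (measurable_const.prodMk measurable_snd))))
    rw [setLIntegral_congr_fun measurableSet_Ioi h1,
      setLIntegral_Ioi_expMeasure hy.le
        (fun v => ∫⁻ z, H (y, (z.1, seqCons v z.2)) ∂(pathMeasure μ₁ μ₂)),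
      lintegral_pathMeasure_cons_right hμ₁ hμ₂ (f := fun z => H (y, z)) (by fun_prop),
      expMeasure_Ioi hμ₂ hy.le]
  lintegral_done H hH := by
    rw [setLIntegral_done hμ₁ hμ₂ (f := fun z => H (z.1 0, nextBlock z))
      (hH.comp (Measurable.prodMk (by fun_prop) measurable_nextBlock))]
    refine lintegral_congr fun y => ?_
    have h1 : ∀ v ∈ Set.Iic y, ∫⁻ z, H ((seqCons y z.1) 0,
        nextBlock (seqCons y z.1, seqCons v z.2)) ∂(pathMeasure μ₁ μ₂) =
        ∫⁻ z, H (y, z) ∂(pathMeasure μ₁ μ₂) := by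
      intro v hv
      refine lintegral_congr fun z => ?_
      congr 2
      simp only [nextBlock, seqCons]
      refine Prod.ext rfl (funext fun k => ?_)
      cases k <;> simp [seqCons, Set.mem_Iic.1 hv]
    rw [setLIntegral_congr_fun measurableSet_Iic h1, setLIntegral_const, mul_comm]

end Refresh

end Tandem

/-! ### The tail of the age and its total mass -/

namespace Tandem

/-- All execution times are nonnegative. -/
def NonnegPath (z : Path) : Prop := (∀ k, 0 ≤ z.1 k) ∧ ∀ k, 0 ≤ z.2 k

lemma ae_nonnegPath {μ₁ μ₂ : ℝ} (hμ₁ : 0 < μ₁) (hμ₂ : 0 < μ₂) :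
    ∀ᵐ z ∂(pathMeasure μ₁ μ₂), NonnegPath z := by
  have := isProbabilityMeasure_expMeasure hμ₁
  have := isProbabilityMeasure_expMeasure hμ₂
  have h : ∀ {r : ℝ}, 0 < r → [IsProbabilityMeasure (expMeasure r)] →
      ∀ᵐ x ∂(Measure.infinitePi fun _ : ℕ => expMeasure r), ∀ k, 0 ≤ x k := by
    intro r hr _
    refine ae_all_iff.2 fun k => ?_
    refine ((measurePreserving_eval_infinitePi (fun _ : ℕ => expMeasure r) k).quasiMeasurePreserving).ae
      (p := fun y => 0 ≤ y) ?_
    filter_upwards [ae_expMeasure_pos hr] with y hy using hy.le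
  have h1 := Measure.quasiMeasurePreserving_fst (μ := Measure.infinitePi fun _ : ℕ => expMeasure μ₁)
    (ν := Measure.infinitePi fun _ : ℕ => expMeasure μ₂) |>.ae (h hμ₁)
  have h2 := Measure.quasiMeasurePreserving_snd (μ := Measure.infinitePi fun _ : ℕ => expMeasure μ₁)
    (ν := Measure.infinitePi fun _ : ℕ => expMeasure μ₂) |>.ae (h hμ₂)
  filter_upwards [h1, h2] with z hz1 hz2 using ⟨hz1, hz2⟩

/-- The weights of the busy and the done case add up to one, so what is left over is independent of
the first execution time. -/
lemma Refresh.lintegral_next {μ₁ μ₂ : ℝ} (hμ₁ : 0 < μ₁) (hμ₂ : 0 < μ₂) {next : Path → Path}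
    (hnext : Refresh μ₁ μ₂ next) {H : ℝ × Path → ENNReal} (hH : Measurable H) :
    ∫⁻ z, H (z.1 0, next z) ∂(pathMeasure μ₁ μ₂) =
      ∫⁻ y, ∫⁻ z, H (y, z) ∂(pathMeasure μ₁ μ₂) ∂(expMeasure μ₁) := by
  have := isProbabilityMeasure_expMeasure hμ₂
  have hc : {z : Path | z.1 0 < z.2 0}ᶜ = {z : Path | z.2 0 ≤ z.1 0} := by ext; simp
  have hm : Measurable fun y => expMeasure μ₂ (Set.Ioi y) :=
    Antitone.measurable fun a b hab => measure_mono (Set.Ioi_subset_Ioi hab)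
  have hQ := isProbabilityMeasure_pathMeasure hμ₁ hμ₂
  have hm' : Measurable fun y => expMeasure μ₂ (Set.Ioi y) *
      ∫⁻ z, H (y, z) ∂(pathMeasure μ₁ μ₂) := hm.mul hH.lintegral_prod_right'
  rw [← lintegral_add_compl _ measurableSet_busy, hc, hnext.lintegral_busy H hH,
    hnext.lintegral_done H hH, ← lintegral_add_left hm']
  refine lintegral_congr fun y => ?_
  rw [← add_mul, ← Set.compl_Iic, add_comm, measure_add_measure_compl measurableSet_Iic,
    measure_univ, one_mul]

/-- `N u t` behaves like the set of paths on which no update generated after time `u` is delivered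
by time `t`, when an update reaches server 2 at time `0` and server 1 starts a fresh one then. If
server 2 is finished before the first execution of step 1 ends, the first fresh delivery takes place
at time `τ`. -/
structure FreshFamily (next : Path → Path) (N : ℝ → ℝ → Set Path) (τ : Path → ℝ) : Prop where
  measurableSet : MeasurableSet {p : (ℝ × ℝ) × Path | p.2 ∈ N p.1.1 p.1.2}
  measurable : Measurable τ
  nonneg : ∀ z, NonnegPath z → 0 ≤ τ z
  shift : ∀ z, NonnegPath z → ∀ u t, 0 ≤ u → (z ∈ N u t ↔ next z ∈ N (u - z.1 0) (t - z.1 0))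
  -- The value `-1` represents all negative times: the update that server 1 starts at time `0` then
  -- counts as fresh.
  neg : ∀ z, NonnegPath z → ∀ u t, u < 0 → (z ∈ N u t ↔ z ∈ N (-1) t)
  past : ∀ z, NonnegPath z → ∀ u t, t < 0 → z ∈ N u t
  done : ∀ z, NonnegPath z → z.2 0 ≤ z.1 0 → ∀ t, (z ∈ N (-1) t ↔ t < τ z)
  busy : ∀ z, NonnegPath z → z.1 0 < z.2 0 → ∀ t, (z ∈ N (-1) t ↔ next z ∈ N (-1) (t - z.1 0))

section

variable {μ₁ μ₂ : ℝ} {next : Path → Path} {N : ℝ → ℝ → Set Path} {τ : Path → ℝ}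

lemma FreshFamily.measurableSet_section (hN : FreshFamily next N τ) (u t : ℝ) :
    MeasurableSet (N u t) :=
  hN.measurableSet.preimage (f := fun z : Path => ((u, t), z)) (by fun_prop)

lemma FreshFamily.measurable_measure (hμ₁ : 0 < μ₁) (hμ₂ : 0 < μ₂) (hN : FreshFamily next N τ) :
    Measurable fun p : ℝ × ℝ => pathMeasure μ₁ μ₂ (N p.1 p.2) := by
  have := isProbabilityMeasure_pathMeasure hμ₁ hμ₂
  exact measurable_measure_prodMk_left hN.measurableSet

lemma FreshFamily.measure_eq_lintegral (hμ₁ : 0 < μ₁) (hμ₂ : 0 < μ₂) {next' : Path → Path}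
    (hnext : Refresh μ₁ μ₂ next') (hN : FreshFamily next N τ) (u t : ℝ) :
    pathMeasure μ₁ μ₂ {z | next' z ∈ N (u - z.1 0) (t - z.1 0)} =
      ∫⁻ y, pathMeasure μ₁ μ₂ (N (u - y) (t - y)) ∂(expMeasure μ₁) := by
  have hS : MeasurableSet {p : ℝ × Path | p.2 ∈ N (u - p.1) (t - p.1)} :=
    hN.measurableSet.preimage (f := fun p : ℝ × Path => ((u - p.1, t - p.1), p.2)) (by fun_prop)
  have h := hnext.lintegral_next hμ₁ hμ₂ (H := Set.indicator {p : ℝ × Path | p.2 ∈ N (u - p.1) (t - p.1)} 1)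
    (measurable_one.indicator hS)
  have hS' : MeasurableSet {z | next' z ∈ N (u - z.1 0) (t - z.1 0)} :=
    hS.preimage (f := fun z : Path => (z.1 0, next' z))
      (Measurable.prodMk (by fun_prop) hnext.measurable)
  rw [← lintegral_indicator_one hS']
  refine Eq.trans ?_ (h.trans ?_)
  · rfl
  · refine lintegral_congr fun y => ?_
    rw [← lintegral_indicator_one (hN.measurableSet_section _ _)]
    rfl

/-- The probability that no update generated after a given time has been delivered `a` units of
time later. -/
noncomputable def freshTail (μ₁ μ₂ : ℝ) (N : ℝ → ℝ → Set Path) (a : ℝ) : ENNReal :=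
  ∫⁻ y, pathMeasure μ₁ μ₂ (N (-1) (a - y)) ∂(expMeasure μ₁)

lemma FreshFamily.measurable_freshTail (hμ₁ : 0 < μ₁) (hμ₂ : 0 < μ₂)
    (hN : FreshFamily next N τ) : Measurable (freshTail μ₁ μ₂ N) := by
  have := isProbabilityMeasure_expMeasure hμ₁
  have h : Measurable fun p : ℝ × ℝ => pathMeasure μ₁ μ₂ (N (-1) (p.1 - p.2)) :=
    (hN.measurable_measure hμ₁ hμ₂).comp
      (by fun_prop : Measurable fun p : ℝ × ℝ => ((-1 : ℝ), p.1 - p.2))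
  exact h.lintegral_prod_right'

/-- Condition on the first completion of step 1. If it comes after `u`, its overshoot beyond `u` is
exponential again and contributes `freshTail`; if it comes at `y ≤ u`, the same problem restarts
with `u - y`. A constant solves the resulting renewal equation, so it is the solution. -/
lemma FreshFamily.measure_eq_freshTail (hμ₁ : 0 < μ₁) (hμ₂ : 0 < μ₂)
    (hnext : Refresh μ₁ μ₂ next) (hN : FreshFamily next N τ) {u : ℝ} (hu : 0 ≤ u) (a : ℝ) :
    pathMeasure μ₁ μ₂ (N u (u + a)) = freshTail μ₁ μ₂ N a := by
  have := isProbabilityMeasure_pathMeasure hμ₁ hμ₂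
  have := isProbabilityMeasure_expMeasure hμ₁
  have hsh : ∀ u, 0 ≤ u → pathMeasure μ₁ μ₂ (N u (u + a)) =
      pathMeasure μ₁ μ₂ {z | next z ∈ N (u - z.1 0) (u + a - z.1 0)} := by
    intro u hu
    refine measure_congr ?_
    filter_upwards [ae_nonnegPath hμ₁ hμ₂] with z hz
    exact propext (hN.shift z hz u (u + a) hu)
  have key : ∀ u, 0 ≤ u → pathMeasure μ₁ μ₂ (N u (u + a)) =
      ∫⁻ y, pathMeasure μ₁ μ₂ (N (u - y) (u + a - y)) ∂(expMeasure μ₁) := fun u hu => by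
    rw [hsh u hu, hN.measure_eq_lintegral hμ₁ hμ₂ hnext]
  have hn : ∀ u t, u < 0 → pathMeasure μ₁ μ₂ (N u t) = pathMeasure μ₁ μ₂ (N (-1) t) := by
    intro u t hu
    refine measure_congr ?_
    filter_upwards [ae_nonnegPath hμ₁ hμ₂] with z hz
    exact propext (hN.neg z hz u t hu)
  refine renewal_unique hμ₁ (φ := fun u => pathMeasure μ₁ μ₂ (N u (u + a)))
    (ψ := fun _ => freshTail μ₁ μ₂ N a)
    (g := fun u => ENNReal.ofReal (Real.exp (-(μ₁ * u))) * freshTail μ₁ μ₂ N a)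
    (fun t _ => prob_le_one) (fun t _ => ?_) (fun u hu => ?_) (fun u hu => ?_) hu
  · calc freshTail μ₁ μ₂ N a ≤ ∫⁻ y, 1 ∂(expMeasure μ₁) := lintegral_mono fun y => prob_le_one
      _ = 1 := by simp
  · rw [key u hu, ← lintegral_add_compl _ measurableSet_Iic (A := Set.Iic u), add_comm,
      Set.compl_Iic]
    congr 1
    · rw [freshTail, ← setLIntegral_Ioi_expMeasure hu
        (fun y => pathMeasure μ₁ μ₂ (N (-1) (a - y)))]
      refine setLIntegral_congr_fun measurableSet_Ioi fun y hy => ?_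
      rw [hn _ _ (sub_neg.2 hy)]
      congr 2; ring
    · refine lintegral_congr fun y => ?_
      congr 2; ring
  · rw [setLIntegral_const, expMeasure_Iic hμ₁ hu, mul_comm (freshTail μ₁ μ₂ N a), ← add_mul,
      ← ENNReal.ofReal_add (Real.exp_pos _).le]
    · simp
    · simp only [sub_nonneg, Real.exp_le_one_iff]
      nlinarith

/-- Only the law of the leftover path matters, so another refreshing map may replace `next`. This
serves the idle start, where the first arrival begins a new service although later arrivals may be
blocked. -/
lemma FreshFamily.measure_next_eq_freshTail (hμ₁ : 0 < μ₁) (hμ₂ : 0 < μ₂) {next' : Path → Path}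
    (hnext' : Refresh μ₁ μ₂ next') (hnext : Refresh μ₁ μ₂ next) (hN : FreshFamily next N τ)
    {u : ℝ} (hu : 0 ≤ u) (a : ℝ) :
    pathMeasure μ₁ μ₂ {z | next' z ∈ N (u - z.1 0) (u + a - z.1 0)} = freshTail μ₁ μ₂ N a := by
  rw [hN.measure_eq_lintegral hμ₁ hμ₂ hnext', ← hN.measure_eq_lintegral hμ₁ hμ₂ hnext,
    ← hN.measure_eq_freshTail hμ₁ hμ₂ hnext hu]
  refine measure_congr ?_
  filter_upwards [ae_nonnegPath hμ₁ hμ₂] with z hz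
  exact propext (hN.shift z hz u (u + a) hu).symm

/-- The term `1 / μ₁` is the mean wait for the first completion of step 1. The rest is the mean time
from there to a fresh delivery, where `(μ₁ + μ₂) / μ₂ = 1 / (1 - θ)` with `θ = μ₁ / (μ₁ + μ₂)` the
probability that server 1 wins the race. -/
lemma FreshFamily.lintegral_freshTail (hμ₁ : 0 < μ₁) (hμ₂ : 0 < μ₂)
    (hnext : Refresh μ₁ μ₂ next) (hN : FreshFamily next N τ) {c : ℝ} (hc : 0 ≤ c)
    (hτ : ∫⁻ z in {z | z.2 0 ≤ z.1 0}, ENNReal.ofReal (τ z) ∂(pathMeasure μ₁ μ₂) =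
      ENNReal.ofReal c) :
    ∫⁻ a in Set.Ioi 0, freshTail μ₁ μ₂ N a = ENNReal.ofReal
      (1 / μ₁ + (c + μ₁ / (μ₁ + μ₂) ^ 2) * ((μ₁ + μ₂) / μ₂)) := by
  have := isProbabilityMeasure_pathMeasure hμ₁ hμ₂
  have := isProbabilityMeasure_expMeasure hμ₁
  set n : ℝ → ENNReal := fun t => pathMeasure μ₁ μ₂ (N (-1) t) with hn
  have hnm : Measurable n := (hN.measurable_measure hμ₁ hμ₂).comp (g := fun p : ℝ × ℝ => _)
    (f := fun t : ℝ => ((-1 : ℝ), t)) (by fun_prop)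
  have hneg : ∀ t, t < 0 → n t = 1 := by
    intro t ht
    rw [hn, ← measure_univ (μ := pathMeasure μ₁ μ₂)]
    refine measure_congr ?_
    filter_upwards [ae_nonnegPath hμ₁ hμ₂] with z hz
    exact propext (iff_true_intro (hN.past z hz _ t ht))
  -- The probability that server 2 is still busy after an execution of step 1 of length `y`; it
  -- makes the renewal equation defective.
  set k : ℝ → ENNReal := fun y => ENNReal.ofReal (Real.exp (-(μ₂ * y))) with hk
  set a : ℝ → ENNReal := fun t => pathMeasure μ₁ μ₂ {z | t < τ z ∧ z.2 0 ≤ z.1 0} with ha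
  have heq : ∀ t, n t = a t + ∫⁻ y, k y * n (t - y) ∂(expMeasure μ₁) := by
    intro t
    have hR : ∫⁻ y, k y * n (t - y) ∂(expMeasure μ₁) =
        pathMeasure μ₁ μ₂ {z | next z ∈ N (-1) (t - z.1 0) ∧ z.1 0 < z.2 0} := by
      have hS : MeasurableSet {p : ℝ × Path | p.2 ∈ N (-1) (t - p.1)} :=
        hN.measurableSet.preimage (f := fun p : ℝ × Path => (((-1 : ℝ), t - p.1), p.2))
          (by fun_prop)
      have h := hnext.lintegral_busy _ (measurable_one.indicator hS)
      have hS' : MeasurableSet {z | next z ∈ N (-1) (t - z.1 0)} :=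
        hS.preimage (f := fun z : Path => (z.1 0, next z))
          (Measurable.prodMk (by fun_prop) hnext.measurable)
      rw [Set.ofPred_and, ← Measure.restrict_apply hS', ← lintegral_indicator_one hS']
      refine Eq.trans ?_ (h.symm.trans rfl)
      refine lintegral_congr_ae ?_
      filter_upwards [ae_expMeasure_pos hμ₁] with y hy
      change _ * pathMeasure μ₁ μ₂ (N (-1) (t - y)) = _
      rw [expMeasure_Ioi hμ₂ hy.le, ← lintegral_indicator_one (hN.measurableSet_section _ _)]
      rfl
    change pathMeasure μ₁ μ₂ (N (-1) t) = _
    rw [hR, ← measure_inter_add_sdiff (N (-1) t) measurableSet_done]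
    congr 1
    · refine measure_congr ?_
      filter_upwards [ae_nonnegPath hμ₁ hμ₂] with z hz
      exact propext (and_congr_left fun h => hN.done z hz h t)
    · refine measure_congr ?_
      filter_upwards [ae_nonnegPath hμ₁ hμ₂] with z hz
      refine propext ?_
      change (z ∈ N (-1) t ∧ ¬ z.2 0 ≤ z.1 0) ↔ (_ ∧ _)
      rw [not_le]
      exact and_congr_left fun h => hN.busy z hz h t
  have hIa : ∫⁻ t in Set.Ioi 0, a t = ENNReal.ofReal c := by
    rw [← hτ, lintegral_eq_lintegral_meas_lt _ (ae_restrict_of_ae ?_) hN.measurable.aemeasurable]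
    · refine lintegral_congr fun t => ?_
      rw [Measure.restrict_apply (measurableSet_lt measurable_const hN.measurable)]
      rfl
    · filter_upwards [ae_nonnegPath hμ₁ hμ₂] with z hz using hN.nonneg z hz
  have hθ : ∫⁻ y, k y ∂(expMeasure μ₁) = ENNReal.ofReal (μ₁ / (μ₁ + μ₂)) :=
    lintegral_expMeasure_ofReal_exp hμ₁ hμ₂.le
  have hky := lintegral_expMeasure_ofReal_mul_exp hμ₁ hμ₂.le
  obtain ⟨hfin, hI⟩ := lintegral_defective_renewal hμ₁ hnm (by fun_prop) (fun t => prob_le_one)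
    hneg (fun t _ => heq t) (hθ.trans_lt (by
      rw [ENNReal.ofReal_lt_one, div_lt_one (by positivity)]; linarith))
    (by simp [hIa]) (by rw [hky]; simp)
  have hI' : ∫⁻ t in Set.Ioi 0, n t = ENNReal.ofReal
      ((c + μ₁ / (μ₁ + μ₂) ^ 2) * ((μ₁ + μ₂) / μ₂)) := by
    rw [hIa, hky, hθ] at hI
    rw [← ENNReal.ofReal_toReal hfin] at hI ⊢
    set J := (∫⁻ t in Set.Ioi 0, n t).toReal
    have hJ : 0 ≤ J := ENNReal.toReal_nonneg
    rw [← ENNReal.ofReal_add hc (by positivity), ← ENNReal.ofReal_mul (by positivity),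
      ← ENNReal.ofReal_add (by positivity) (by positivity),
      ENNReal.ofReal_eq_ofReal_iff hJ (by positivity)] at hI
    congr 1
    have hl : μ₁ + μ₂ ≠ 0 := by positivity
    field_simp at hI ⊢
    linarith
  have hswap : ∫⁻ a in Set.Ioi 0, freshTail μ₁ μ₂ N a =
      ∫⁻ y, (∫⁻ t in Set.Ioi 0, n (t - y)) ∂(expMeasure μ₁) := by
    unfold freshTail
    refine lintegral_lintegral_swap ?_
    exact Measurable.aemeasurable (hnm.comp (by fun_prop : Measurable fun p : ℝ × ℝ => p.1 - p.2))
  rw [hswap]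
  have : ∫⁻ y, (∫⁻ t in Set.Ioi 0, n (t - y)) ∂(expMeasure μ₁) =
      ∫⁻ y, (ENNReal.ofReal y + (∫⁻ t in Set.Ioi 0, n t)) ∂(expMeasure μ₁) := by
    refine lintegral_congr_ae ?_
    filter_upwards [ae_expMeasure_pos hμ₁] with y hy using setLIntegral_Ioi_sub hneg hy.le
  rw [this, lintegral_add_left (by fun_prop), lintegral_expMeasure_ofReal hμ₁, hI']
  simp only [lintegral_const, measure_univ, mul_one]
  rw [← ENNReal.ofReal_add (by positivity) (by positivity)]

end

end Tandem

/-! ### From the tail of the age to its mean -/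

namespace Tandem

/-- An age whose law at time `t` is `κ` up to age `t` converges in mean to the total mass of `κ`. -/
lemma isAverageAge_of_tail {Ω : Type*} [MeasurableSpace Ω] {P : Measure Ω} [IsProbabilityMeasure P]
    {Δ : ℝ → Ω → ℝ} {a₀ m : ℝ} (hm : 0 ≤ m) {κ : ℝ → ENNReal}
    (hκm : Measurable κ) (hmeas : ∀ t, 0 ≤ t → AEMeasurable (Δ t) P)
    (hb : ∀ t, 0 ≤ t → ∀ᵐ ω ∂P, 0 ≤ Δ t ω ∧ Δ t ω ≤ t + a₀)
    (htail : ∀ t a, 0 < a → a ≤ t → P {ω | a ≤ Δ t ω} = κ a)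
    (hκ : ∫⁻ a in Set.Ioi 0, κ a = ENNReal.ofReal m) : IsAverageAge P Δ m := by
  have hle : ∀ t a, 0 < a → a ≤ t → κ t ≤ κ a := by
    intro t a ha hat
    rw [← htail t a ha hat, ← htail t t (ha.trans_le hat) le_rfl]
    exact measure_mono fun ω hω => hat.trans hω
  -- A nonincreasing integrable tail satisfies `t * κ t ≤ m`.
  have hκ0 : Tendsto κ atTop (𝓝 0) := by
    have h1 : ∀ᶠ t : ℝ in atTop, κ t ≤ ENNReal.ofReal (m / t) := by
      filter_upwards [eventually_gt_atTop 0] with t ht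
      have h2 : κ t * ENNReal.ofReal t ≤ ENNReal.ofReal m := by
        calc κ t * ENNReal.ofReal t = ∫⁻ a in Set.Ioc 0 t, κ t := by simp
          _ ≤ ∫⁻ a in Set.Ioc 0 t, κ a := setLIntegral_mono hκm fun a ha => hle t a ha.1 ha.2
          _ ≤ ∫⁻ a in Set.Ioi 0, κ a := lintegral_mono_set Set.Ioc_subset_Ioi_self
          _ = _ := hκ
      rw [ENNReal.ofReal_div_of_pos ht]
      exact (ENNReal.le_div_iff_mul_le (.inl (by simpa using ht)) (.inl ENNReal.ofReal_ne_top)).2 h2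
    have h3 : Tendsto (fun t : ℝ => ENNReal.ofReal (m / t)) atTop (𝓝 0) := by
      simpa using ENNReal.tendsto_ofReal ((tendsto_const_nhds (x := m)).div_atTop tendsto_id)
    exact tendsto_of_tendsto_of_tendsto_of_le_of_le' tendsto_const_nhds h3
      (Eventually.of_forall fun _ => zero_le) h1
  have hint : ∀ t, 0 ≤ t → Integrable (Δ t) P := by
    intro t ht
    refine Integrable.of_bound (hmeas t ht).aestronglyMeasurable (t + a₀) ?_
    filter_upwards [hb t ht] with ω hω
    rw [Real.norm_of_nonneg hω.1]
    exact hω.2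
  refine ⟨hint, ?_⟩
  have hJ : ∀ t, 0 ≤ t → ∫⁻ ω, ENNReal.ofReal (Δ t ω) ∂P =
      (∫⁻ a in Set.Ioc 0 t, κ a) + ∫⁻ a in Set.Ioi t, P {ω | a ≤ Δ t ω} := by
    intro t ht
    rw [lintegral_eq_lintegral_meas_le P ((hb t ht).mono fun ω h => h.1) (hmeas t ht),
      ← Set.Ioc_union_Ioi_eq_Ioi ht, lintegral_union measurableSet_Ioi Set.Ioc_disjoint_Ioi_same]
    congr 1
    exact setLIntegral_congr_fun measurableSet_Ioc fun a ha => htail t a ha.1 ha.2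
  -- Ages above `t` remember the initial state. They fill an interval of length at most `a₀`, on
  -- which the tail is at most `κ t`.
  have hrest : ∀ t, 0 < t → ∫⁻ a in Set.Ioi t, P {ω | a ≤ Δ t ω} ≤ κ t * ENNReal.ofReal a₀ := by
    intro t ht
    calc ∫⁻ a in Set.Ioi t, P {ω | a ≤ Δ t ω}
        ≤ ∫⁻ a in Set.Ioi t, (Set.Ioc t (t + a₀)).indicator (fun _ => κ t) a := by
          refine setLIntegral_mono (measurable_const.indicator measurableSet_Ioc) fun a ha => ?_
          by_cases h : a ≤ t + a₀
          · rw [Set.indicator_of_mem (show a ∈ Set.Ioc t (t + a₀) from ⟨ha, h⟩), ← htail t t ht le_rfl]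
            exact measure_mono fun ω (hω : a ≤ Δ t ω) => (Set.mem_Ioi.1 ha).le.trans hω
          · refine le_of_eq_of_le ?_ (zero_le)
            refine measure_eq_zero_iff_ae_notMem.2 ?_
            filter_upwards [hb t ht.le] with ω hω hω'
            exact h (le_trans hω' hω.2)
      _ ≤ ∫⁻ a, (Set.Ioc t (t + a₀)).indicator (fun _ => κ t) a := setLIntegral_le_lintegral _ _
      _ = _ := by rw [lintegral_indicator measurableSet_Ioc]; simp
  have hlim : Tendsto (fun t => ∫⁻ ω, ENNReal.ofReal (Δ t ω) ∂P) atTop (𝓝 (ENNReal.ofReal m)) := by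
    have h1 : Tendsto (fun t : ℝ => ∫⁻ a in Set.Ioc 0 t, κ a) atTop (𝓝 (ENNReal.ofReal m)) := by
      have h2 := (aecover_Iic (μ := (volume : Measure ℝ).restrict (Set.Ioi 0))
        (tendsto_id (α := ℝ) (x := atTop))).lintegral_tendsto_of_countably_generated
        hκm.aemeasurable
      rw [hκ] at h2
      refine h2.congr fun t => ?_
      rw [Measure.restrict_restrict measurableSet_Iic]
      congr 2
      ext a; simp [and_comm]
    have h3 : Tendsto (fun t => (∫⁻ a in Set.Ioc 0 t, κ a) + κ t * ENNReal.ofReal a₀) atTop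
        (𝓝 (ENNReal.ofReal m)) := by
      simpa using h1.add (ENNReal.Tendsto.mul_const hκ0 (.inr ENNReal.ofReal_ne_top))
    refine tendsto_of_tendsto_of_tendsto_of_le_of_le' h1 h3 ?_ ?_
    · filter_upwards [eventually_gt_atTop 0] with t ht
      rw [hJ t ht.le]
      exact le_self_add
    · filter_upwards [eventually_gt_atTop 0] with t ht
      rw [hJ t ht.le]
      gcongr
      exact hrest t ht
  have := (ENNReal.tendsto_toReal ENNReal.ofReal_ne_top).comp hlim
  rw [ENNReal.toReal_ofReal hm] at this
  refine this.congr' ?_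
  filter_upwards [eventually_ge_atTop 0] with t ht
  rw [integral_eq_lintegral_of_nonneg_ae ((hb t ht).mono fun ω h => h.1)
    (hmeas t ht).aestronglyMeasurable]
  rfl

lemma IsAverageAge.of_hasLaw {Ω Ω' : Type*} [MeasurableSpace Ω] [MeasurableSpace Ω']
    {P : Measure Ω} {Q : Measure Ω'} {Y : Ω → Ω'} (hY : HasLaw Y Q P) {Δ : ℝ → Ω' → ℝ} {a : ℝ}
    (h : IsAverageAge Q Δ a) : IsAverageAge P (fun t ω => Δ t (Y ω)) a := by
  have h1 : ∀ t, 0 ≤ t → Integrable (fun ω => Δ t (Y ω)) P := by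
    intro t ht
    have := h.1 t ht
    rw [← hY.map_eq] at this
    exact this.comp_aemeasurable hY.aemeasurable
  refine ⟨h1, h.2.congr' ?_⟩
  filter_upwards [eventually_ge_atTop 0] with t ht
  exact (hY.integral_comp (h.1 t ht).aestronglyMeasurable).symm

/-! ### The age as a supremum over delivered updates -/

section MonitorAge

variable {a₀ : ℝ} {gen : ℕ → ℝ} {delivered : ℕ → Prop} {t : ℝ}

lemma bddAbove_delivered (hgen : ∀ k, delivered k → gen k ≤ t) :
    BddAbove (insert (-a₀) (gen '' {k | delivered k})) := by
  refine BddAbove.insert _ ⟨t, ?_⟩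
  rintro _ ⟨k, hk, rfl⟩
  exact hgen k hk

/-- Delivered updates were generated by time `t`, so the supremum is a genuine one and not the
default value `0` of an unbounded set. -/
lemma le_monitorAge_iff (hgen : ∀ k, delivered k → gen k ≤ t) {a : ℝ} :
    a ≤ monitorAge a₀ gen delivered t ↔ a ≤ t + a₀ ∧ ∀ k, delivered k → gen k ≤ t - a := by
  unfold monitorAge
  rw [le_sub_comm, csSup_le_iff (bddAbove_delivered hgen) (Set.insert_nonempty _ _)]
  constructor
  · intro h
    refine ⟨?_, fun k hk => h _ (Set.mem_insert_of_mem _ ⟨k, hk, rfl⟩)⟩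
    have := h _ (Set.mem_insert _ _)
    linarith
  · rintro ⟨h0, h⟩ b (rfl | ⟨k, hk, rfl⟩)
    · linarith
    · exact h k hk

lemma monitorAge_le (hgen : ∀ k, delivered k → gen k ≤ t) :
    monitorAge a₀ gen delivered t ≤ t + a₀ :=
  ((le_monitorAge_iff hgen).1 le_rfl).1

lemma measurable_monitorAge {Z : Type*} [MeasurableSpace Z] {gen : Z → ℕ → ℝ}
    {delivered : Z → ℕ → Prop} (hg : ∀ k, Measurable fun z => gen z k)
    (hd : ∀ k, MeasurableSet {z | delivered z k}) (a₀ t : ℝ) :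
    Measurable fun z => monitorAge a₀ (gen z) (delivered z) t := by
  classical
  -- An undelivered update is made to contribute `-a₀`, which is in the set anyway. The index set
  -- then no longer depends on `z`, and the supremum is a countable one.
  have : ∀ z, insert (-a₀) (gen z '' {k | delivered z k}) =
      Set.range fun o : Option ℕ => o.elim (-a₀) fun k => if delivered z k then gen z k else -a₀ := by
    intro z
    ext b
    simp only [Set.mem_insert_iff, Set.mem_image, Set.mem_range, Option.exists, Option.elim]
    constructor
    · rintro (rfl | ⟨k, hk, rfl⟩)
      · exact .inl rfl
      · exact .inr ⟨k, if_pos hk⟩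
    · rintro (rfl | ⟨k, rfl⟩)
      · exact .inl rfl
      · by_cases hk : delivered z k
        · exact .inr ⟨k, hk, (if_pos hk).symm⟩
        · exact .inl (if_neg hk)
  unfold monitorAge
  simp_rw [this]
  refine measurable_const.sub (Measurable.iSup fun o => ?_)
  cases o with
  | none => exact measurable_const
  | some k => exact Measurable.ite (hd k) (hg k) measurable_const

end MonitorAge

end Tandem

/-! ### Sample paths seen from the first arrival -/

namespace Tandem

section Paths

variable {x s : ℕ → ℝ}

lemma arrivalTime_zero (x : ℕ → ℝ) : arrivalTime x 0 = 0 := by simp [arrivalTime]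

lemma arrivalTime_succ (x : ℕ → ℝ) (k : ℕ) :
    arrivalTime x (k + 1) = x 0 + arrivalTime (fun i => x (i + 1)) k := by
  rw [arrivalTime, Finset.sum_range_succ', add_comm]; rfl

lemma arrivalTime_mono (hx : ∀ k, 0 ≤ x k) : Monotone (arrivalTime x) :=
  monotone_nat_of_le_succ fun k => by
    simp only [arrivalTime, Finset.sum_range_succ]
    linarith [hx k]

lemma arrivalTime_nonneg (hx : ∀ k, 0 ≤ x k) (k : ℕ) : 0 ≤ arrivalTime x k :=
  Finset.sum_nonneg fun i _ => hx i

lemma freeTime_mono (q : ServerState) (hs : ∀ k, 0 ≤ s k) : Monotone (freeTime q x s) :=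
  monotone_nat_of_le_succ fun k => by
    simp only [freeTime]
    split_ifs with h
    · linarith [hs (k + 1)]
    · exact le_rfl

lemma freeTime_zero_busy (x s : ℕ → ℝ) : freeTime 1 x s 0 = s 0 := by simp [freeTime]

lemma freeTime_zero_idle (x s : ℕ → ℝ) : freeTime 0 x s 0 = 0 := by simp [freeTime]

lemma freeTime_succ (q : ServerState) (x s : ℕ → ℝ) (k : ℕ) :
    freeTime q x s (k + 1) =
      if freeTime q x s k ≤ arrivalTime x (k + 1) then arrivalTime x (k + 1) + s (k + 1)
      else freeTime q x s k := rfl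

/-- The first arrival finds server 2 idle and is accepted; from then on the system is one that
started busy. -/
lemma freeTime_idle_succ (hx : 0 ≤ x 0) (k : ℕ) :
    freeTime 0 x s (k + 1) =
      x 0 + freeTime 1 (fun i => x (i + 1)) (fun i => s (i + 1)) k := by
  induction k with
  | zero =>
    rw [freeTime_succ, freeTime_zero_idle, freeTime_zero_busy, arrivalTime_succ, arrivalTime_zero,
      if_pos (by simpa using hx), add_zero]
  | succ k ih =>
    rw [freeTime_succ, ih, freeTime_succ, arrivalTime_succ]
    simp only [add_le_add_iff_left]
    split_ifs <;> ring

/-- Just after the first arrival server 2 is busy in either case, and `nextBlock` records the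
service still to be done. -/
lemma freeTime_busy_succ (x s : ℕ → ℝ) (k : ℕ) :
    freeTime 1 x s (k + 1) =
      x 0 + freeTime 1 (nextBlock (x, s)).1 (nextBlock (x, s)).2 k := by
  induction k with
  | zero =>
    rw [freeTime_succ, freeTime_zero_busy, freeTime_zero_busy, arrivalTime_succ, arrivalTime_zero,
      add_zero]
    simp only [nextBlock, seqCons]
    split_ifs <;> ring
  | succ k ih =>
    rw [freeTime_succ, ih, freeTime_succ, arrivalTime_succ]
    simp only [add_le_add_iff_left, nextBlock, seqCons]
    split_ifs <;> ring

lemma accepted_zero_iff (q : ServerState) (x s : ℕ → ℝ) : Accepted q x s 0 ↔ q = 1 := Iff.rfl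

lemma accepted_succ_iff (q : ServerState) (x s : ℕ → ℝ) (k : ℕ) :
    Accepted q x s (k + 1) ↔ freeTime q x s k ≤ arrivalTime x (k + 1) := Iff.rfl

lemma freeTime_of_accepted {q : ServerState} {k : ℕ} (h : Accepted q x s k) :
    freeTime q x s k = arrivalTime x k + s k := by
  cases k with
  | zero => rw [freeTime, if_pos ((accepted_zero_iff q x s).1 h), arrivalTime_zero, zero_add]
  | succ k => rw [freeTime_succ, if_pos ((accepted_succ_iff q x s k).1 h)]

/-- Server 2 is busy at time `t` if and only if it is still occupied with what it has accepted up to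
some arrival before `t`. -/
lemma exists_accepted_iff (hx : ∀ k, 0 ≤ x k) (q : ServerState) (t : ℝ) :
    (∃ k, Accepted q x s k ∧ arrivalTime x k ≤ t ∧ t < arrivalTime x k + s k) ↔
      ∃ k, arrivalTime x k ≤ t ∧ t < freeTime q x s k := by
  constructor
  · rintro ⟨k, hk, h1, h2⟩
    exact ⟨k, h1, by rwa [freeTime_of_accepted hk]⟩
  · rintro ⟨k, h1, h2⟩
    induction k with
    | zero =>
      by_cases hq : q = 1
      · exact ⟨0, hq, h1, by rwa [← freeTime_of_accepted (k := 0) hq]⟩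
      · rw [freeTime, if_neg hq] at h2
        rw [arrivalTime_zero] at h1
        linarith
    | succ k ih =>
      by_cases hk : freeTime q x s k ≤ arrivalTime x (k + 1)
      · exact ⟨k + 1, hk, h1, by rwa [← freeTime_of_accepted (k := k + 1) hk]⟩
      · rw [freeTime, if_neg hk] at h2
        exact ih ((arrivalTime_mono hx (Nat.le_succ k)).trans h1) h2

end Paths

/-! ### No fresh delivery: restarting both models -/

/-- The paths on which no update generated after time `u` is delivered by time `t` in the M/M/1/1
model, if server 2 is busy at time `0` and server 1 starts a fresh update then. -/
def noFreshMM11 (u t : ℝ) : Set Path :=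
  {z | ¬ ∃ k, u < arrivalTime z.1 k ∧ freeTime 1 z.1 z.2 k ≤ arrivalTime z.1 (k + 1) ∧
    arrivalTime z.1 (k + 1) + z.2 (k + 1) ≤ t}

/-- The paths on which no update that reaches server 2 after time `u` is delivered by time `t` in the
M/M/1* model, if an update reaches server 2 at time `0`. -/
def noFreshMM1Star (u t : ℝ) : Set Path :=
  {z | ¬ ∃ k, u < arrivalTime z.1 k ∧ arrivalTime z.1 k + z.2 k ≤ arrivalTime z.1 (k + 1) ∧
    arrivalTime z.1 k + z.2 k ≤ t}

/-- The paths on which server 2 is busy at time `t`, being busy at time `0`. -/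
def busyAt (t : ℝ) : Set Path :=
  {z | ∃ k, arrivalTime z.1 k ≤ t ∧ t < freeTime 1 z.1 z.2 k}

lemma measurable_arrivalTime (k : ℕ) : Measurable fun z : Path => arrivalTime z.1 k := by
  unfold arrivalTime; fun_prop

lemma measurable_freeTime (q : ServerState) (k : ℕ) :
    Measurable fun z : Path => freeTime q z.1 z.2 k := by
  induction k with
  | zero => simp only [freeTime]; split_ifs <;> fun_prop
  | succ k ih =>
    simp only [freeTime]
    have := measurable_arrivalTime (k + 1)
    exact Measurable.ite (measurableSet_le ih this) (this.add (by fun_prop)) ih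

/-- Update `k + 1` is generated at arrival `k`, so update `0` is stale and update `1`, generated at
time `0`, is the first candidate. If server 2 finishes first, update `1` is accepted at `x 0` and
delivered at `x 0 + s 1`; otherwise it is discarded. -/
lemma freshFamily_noFreshMM11 :
    FreshFamily nextBlock noFreshMM11 (fun z => z.1 0 + z.2 1) where
  measurableSet := by
    have hA := measurable_arrivalTime
    have hV := measurable_freeTime 1
    have : {p : (ℝ × ℝ) × Path | p.2 ∈ noFreshMM11 p.1.1 p.1.2} =
        (⋃ k, {p : (ℝ × ℝ) × Path | p.1.1 < arrivalTime p.2.1 k ∧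
          freeTime 1 p.2.1 p.2.2 k ≤ arrivalTime p.2.1 (k + 1) ∧
          arrivalTime p.2.1 (k + 1) + p.2.2 (k + 1) ≤ p.1.2})ᶜ := by
      ext p; rw [Set.mem_compl_iff, Set.mem_iUnion]; rfl
    rw [this]
    refine (MeasurableSet.iUnion fun k => ?_).compl
    refine (measurableSet_lt (by fun_prop) ((hA k).comp measurable_snd)).inter
      ((measurableSet_le ((hV k).comp measurable_snd) ((hA (k + 1)).comp measurable_snd)).inter
      (measurableSet_le (((hA (k + 1)).comp measurable_snd).add (by fun_prop)) (by fun_prop)))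
  measurable := by fun_prop
  nonneg z hz := add_nonneg (hz.1 0) (hz.2 1)
  shift := by
    rintro ⟨x, s⟩ hz u t hu
    refine not_congr ?_
    rw [← Nat.or_exists_add_one]
    have h0 : ¬ u < arrivalTime x 0 := by rw [arrivalTime_zero]; exact not_lt.2 hu
    simp only [h0, false_and, false_or]
    refine exists_congr fun k => ?_
    rw [freeTime_busy_succ, arrivalTime_succ x k, arrivalTime_succ x (k + 1),
      add_le_add_iff_left, ← sub_lt_iff_lt_add', add_assoc, ← le_sub_iff_add_le']
    rfl
  neg := by
    rintro ⟨x, s⟩ hz u t hu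
    refine not_congr (exists_congr fun k => and_congr_left fun _ => ?_)
    have := arrivalTime_nonneg hz.1 k
    exact iff_of_true (hu.trans_le this) (by simp only; linarith)
  past := by
    rintro ⟨x, s⟩ hz u t ht ⟨k, -, -, h⟩
    have := arrivalTime_nonneg hz.1 (k + 1)
    have := hz.2 (k + 1)
    simp only at *
    linarith
  done := by
    rintro ⟨x, s⟩ hz h0 t
    simp only at h0 ⊢
    have h1 : arrivalTime x 1 = x 0 := by rw [arrivalTime_succ, arrivalTime_zero, add_zero]
    constructor
    · intro h
      by_contra hlt
      refine h ⟨0, ?_, ?_, ?_⟩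
      · simp [arrivalTime_zero]
      · simpa [freeTime_zero_busy, h1] using h0
      · simpa [h1] using hlt
    · rintro h ⟨k, -, h2, h3⟩
      simp only at h2 h3
      cases k with
      | zero => simp only [zero_add, h1] at h3; linarith
      | succ k =>
        -- Any later accepted update arrives after server 2 has finished update `1`, hence not
        -- before `x 0 + s 1`.
        have h4 := freeTime_mono (x := x) 1 hz.2 (Nat.succ_le_succ (Nat.zero_le k))
        have h5 : freeTime 1 x s (0 + 1) = x 0 + s 1 := by
          rw [freeTime, freeTime_zero_busy, zero_add, h1, if_pos h0]
        have := hz.2 (k + 1 + 1)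
        simp only [Nat.succ_eq_add_one] at *
        linarith
  busy := by
    rintro ⟨x, s⟩ hz h0 t
    simp only at h0 ⊢
    refine not_congr ?_
    rw [← Nat.or_exists_add_one]
    have h1 : arrivalTime x 1 = x 0 := by rw [arrivalTime_succ, arrivalTime_zero, add_zero]
    have h2 : ¬ freeTime 1 x s 0 ≤ arrivalTime x (0 + 1) := by
      rw [freeTime_zero_busy, zero_add, h1]; exact not_le.2 h0
    simp only [h2, false_and, and_false, false_or]
    refine exists_congr fun k => and_congr ?_ ?_
    · have h3 := arrivalTime_nonneg hz.1 (k + 1)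
      have h4 := arrivalTime_nonneg (x := (nextBlock (x, s)).1) (fun i => hz.1 (i + 1)) k
      exact iff_of_true (by simp only at *; linarith) (by linarith)
    · rw [freeTime_busy_succ, arrivalTime_succ x (k + 1),
        add_le_add_iff_left, add_assoc, ← le_sub_iff_add_le']
      rfl

/-- Here update `0` has age zero at time `0` and is itself fresh. It is delivered at `s 0` unless
the next arrival preempts it, and later updates arrive no earlier than `x 0`. -/
lemma freshFamily_noFreshMM1Star :
    FreshFamily nextPreempt noFreshMM1Star (fun z => z.2 0) where
  measurableSet := by
    have hA := measurable_arrivalTime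
    have : {p : (ℝ × ℝ) × Path | p.2 ∈ noFreshMM1Star p.1.1 p.1.2} =
        (⋃ k, {p : (ℝ × ℝ) × Path | p.1.1 < arrivalTime p.2.1 k ∧
          arrivalTime p.2.1 k + p.2.2 k ≤ arrivalTime p.2.1 (k + 1) ∧
          arrivalTime p.2.1 k + p.2.2 k ≤ p.1.2})ᶜ := by
      ext p; rw [Set.mem_compl_iff, Set.mem_iUnion]; rfl
    rw [this]
    refine (MeasurableSet.iUnion fun k => ?_).compl
    have h : Measurable fun p : (ℝ × ℝ) × Path => arrivalTime p.2.1 k + p.2.2 k :=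
      ((hA k).comp measurable_snd).add (by fun_prop)
    exact (measurableSet_lt (by fun_prop) ((hA k).comp measurable_snd)).inter
      ((measurableSet_le h ((hA (k + 1)).comp measurable_snd)).inter
      (measurableSet_le h (by fun_prop)))
  measurable := by fun_prop
  nonneg z hz := hz.2 0
  shift := by
    rintro ⟨x, s⟩ hz u t hu
    refine not_congr ?_
    rw [← Nat.or_exists_add_one]
    have h0 : ¬ u < arrivalTime x 0 := by rw [arrivalTime_zero]; exact not_lt.2 hu
    simp only [h0, false_and, false_or]
    refine exists_congr fun k => ?_
    rw [arrivalTime_succ x k, arrivalTime_succ x (k + 1)]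
    simp only [nextPreempt]
    constructor <;> rintro ⟨h1, h2, h3⟩ <;> refine ⟨?_, ?_, ?_⟩ <;> linarith
  neg := by
    rintro ⟨x, s⟩ hz u t hu
    refine not_congr (exists_congr fun k => and_congr_left fun _ => ?_)
    have := arrivalTime_nonneg hz.1 k
    exact iff_of_true (hu.trans_le this) (by simp only; linarith)
  past := by
    rintro ⟨x, s⟩ hz u t ht ⟨k, -, -, h⟩
    have := arrivalTime_nonneg hz.1 k
    have := hz.2 k
    simp only at *
    linarith
  done := by
    rintro ⟨x, s⟩ hz h0 t
    simp only at h0 ⊢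
    have h1 : arrivalTime x 1 = x 0 := by rw [arrivalTime_succ, arrivalTime_zero, add_zero]
    constructor
    · intro h
      by_contra hlt
      refine h ⟨0, ?_, ?_, ?_⟩
      · simp [arrivalTime_zero]
      · simpa [arrivalTime_zero, h1] using h0
      · simpa [arrivalTime_zero] using hlt
    · rintro h ⟨k, -, h2, h3⟩
      simp only at h2 h3
      cases k with
      | zero => rw [arrivalTime_zero] at h3; linarith
      | succ k =>
        have h4 := arrivalTime_mono hz.1 (Nat.succ_le_succ (Nat.zero_le k))
        have := hz.2 (k + 1)
        simp only [Nat.succ_eq_add_one, zero_add, h1] at *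
        linarith
  busy := by
    rintro ⟨x, s⟩ hz h0 t
    simp only at h0 ⊢
    refine not_congr ?_
    rw [← Nat.or_exists_add_one]
    have h1 : arrivalTime x 1 = x 0 := by rw [arrivalTime_succ, arrivalTime_zero, add_zero]
    have h2 : ¬ arrivalTime x 0 + s 0 ≤ arrivalTime x (0 + 1) := by
      rw [arrivalTime_zero, zero_add, zero_add, h1]; exact not_le.2 h0
    simp only [h2, false_and, and_false, false_or]
    refine exists_congr fun k => and_congr ?_ ?_
    · have h3 := arrivalTime_nonneg hz.1 (k + 1)
      have h4 := arrivalTime_nonneg (x := (nextPreempt (x, s)).1) (fun i => hz.1 (i + 1)) k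
      exact iff_of_true (by simp only at *; linarith) (by linarith)
    · rw [arrivalTime_succ x k, arrivalTime_succ x (k + 1)]
      simp only [nextPreempt]
      constructor <;> rintro ⟨h1, h2⟩ <;> refine ⟨?_, ?_⟩ <;> linarith

end Tandem

/-! ### The mean time to a fresh delivery -/

namespace Tandem

section Constants

variable {μ₁ μ₂ : ℝ}

lemma lintegral_step₁ (hμ₁ : 0 < μ₁) (hμ₂ : 0 < μ₂) {g : ℝ → ENNReal} (hg : Measurable g) (k : ℕ) :
    ∫⁻ z, g (z.1 k) ∂(pathMeasure μ₁ μ₂) = ∫⁻ y, g y ∂(expMeasure μ₁) := by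
  have := isProbabilityMeasure_expMeasure hμ₁
  have := isProbabilityMeasure_expMeasure hμ₂
  exact ((measurePreserving_eval_infinitePi (fun _ : ℕ => expMeasure μ₁) k).comp
    (measurePreserving_fst (ν := Measure.infinitePi fun _ : ℕ => expMeasure μ₂))).lintegral_comp hg

lemma lintegral_step₂ (hμ₁ : 0 < μ₁) (hμ₂ : 0 < μ₂) {g : ℝ → ENNReal} (hg : Measurable g) (k : ℕ) :
    ∫⁻ z, g (z.2 k) ∂(pathMeasure μ₁ μ₂) = ∫⁻ y, g y ∂(expMeasure μ₂) := by
  have := isProbabilityMeasure_expMeasure hμ₁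
  have := isProbabilityMeasure_expMeasure hμ₂
  exact ((measurePreserving_eval_infinitePi (fun _ : ℕ => expMeasure μ₂) k).comp
    (measurePreserving_snd (μ := Measure.infinitePi fun _ : ℕ => expMeasure μ₁))).lintegral_comp hg

/-- Integrals over the busy case carry the plain weight `exp (-(μ₂ * y))`, so the done case is
obtained as the complement. -/
lemma setLIntegral_done_eq_sub {f : Path → ENNReal} {a b : ℝ} (hb : 0 ≤ b)
    (ha : ∫⁻ z, f z ∂(pathMeasure μ₁ μ₂) = ENNReal.ofReal a)
    (hbusy : ∫⁻ z in {z | z.1 0 < z.2 0}, f z ∂(pathMeasure μ₁ μ₂) = ENNReal.ofReal b) :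
    ∫⁻ z in {z | z.2 0 ≤ z.1 0}, f z ∂(pathMeasure μ₁ μ₂) = ENNReal.ofReal (a - b) := by
  have hc : {z : Path | z.1 0 < z.2 0}ᶜ = {z : Path | z.2 0 ≤ z.1 0} := by ext; simp
  rw [← lintegral_add_compl _ measurableSet_busy, hc, hbusy] at ha
  rw [ENNReal.ofReal_sub _ hb]
  exact ENNReal.eq_sub_of_add_eq ENNReal.ofReal_ne_top (by rw [add_comm]; exact ha)

lemma setLIntegral_busy_step₁ (hμ₁ : 0 < μ₁) (hμ₂ : 0 < μ₂) :
    ∫⁻ z in {z | z.1 0 < z.2 0}, ENNReal.ofReal (z.1 0) ∂(pathMeasure μ₁ μ₂) =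
      ENNReal.ofReal (μ₁ / (μ₁ + μ₂) ^ 2) := by
  have := isProbabilityMeasure_pathMeasure hμ₁ hμ₂
  rw [setLIntegral_busy hμ₁ hμ₂ (by fun_prop), ← lintegral_expMeasure_ofReal_mul_exp hμ₁ hμ₂.le]
  refine lintegral_congr_ae ?_
  filter_upwards [ae_expMeasure_pos hμ₁] with y hy
  simp [seqCons, expMeasure_Ioi hμ₂ hy.le, mul_comm]

lemma setLIntegral_busy_step₂ (hμ₁ : 0 < μ₁) (hμ₂ : 0 < μ₂) :
    ∫⁻ z in {z | z.1 0 < z.2 0}, ENNReal.ofReal (z.2 0) ∂(pathMeasure μ₁ μ₂) =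
      ENNReal.ofReal (μ₁ / (μ₁ + μ₂) ^ 2 + μ₁ / (μ₁ + μ₂) * (1 / μ₂)) := by
  have := isProbabilityMeasure_pathMeasure hμ₁ hμ₂
  have := isProbabilityMeasure_expMeasure hμ₂
  rw [setLIntegral_busy hμ₁ hμ₂ (by fun_prop), ENNReal.ofReal_add (by positivity) (by positivity),
    ENNReal.ofReal_mul (by positivity), ← lintegral_expMeasure_ofReal_mul_exp hμ₁ hμ₂.le,
    ← lintegral_expMeasure_ofReal_exp hμ₁ hμ₂.le, ← lintegral_mul_const _ (by fun_prop),
    ← lintegral_add_left (by fun_prop)]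
  refine lintegral_congr_ae ?_
  filter_upwards [ae_expMeasure_pos hμ₁] with y hy
  -- A service that outlasts `y` is `y` plus a fresh exponential time.
  have h := setLIntegral_Ioi_expMeasure (r := μ₂) hy.le (fun v => ENNReal.ofReal (v + y))
  simp only [sub_add_cancel] at h
  simp only [seqCons, lintegral_const, measure_univ, mul_one]
  rw [h, ← mul_add, ← lintegral_expMeasure_ofReal hμ₂]
  congr 1
  have h2 : ∫⁻ v, ENNReal.ofReal (v + y) ∂(expMeasure μ₂) =
      ∫⁻ v, (ENNReal.ofReal y + ENNReal.ofReal v) ∂(expMeasure μ₂) := by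
    refine lintegral_congr_ae ?_
    filter_upwards [ae_expMeasure_pos hμ₂] with v hv
    rw [add_comm, ENNReal.ofReal_add hy.le hv.le]
  rw [h2, lintegral_add_left (by fun_prop)]
  simp

lemma setLIntegral_busy_step₂_next (hμ₁ : 0 < μ₁) (hμ₂ : 0 < μ₂) :
    ∫⁻ z in {z | z.1 0 < z.2 0}, ENNReal.ofReal (z.2 1) ∂(pathMeasure μ₁ μ₂) =
      ENNReal.ofReal (μ₁ / (μ₁ + μ₂) * (1 / μ₂)) := by
  rw [setLIntegral_busy hμ₁ hμ₂ (by fun_prop), ENNReal.ofReal_mul (by positivity),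
    ← lintegral_expMeasure_ofReal_exp hμ₁ hμ₂.le, ← lintegral_mul_const _ (by fun_prop)]
  refine lintegral_congr_ae ?_
  filter_upwards [ae_expMeasure_pos hμ₁] with y hy
  simp only [seqCons]
  rw [lintegral_step₂ hμ₁ hμ₂ (g := ENNReal.ofReal) (by fun_prop),
    lintegral_expMeasure_ofReal hμ₂, setLIntegral_const, expMeasure_Ioi hμ₂ hy.le, mul_comm]

lemma lintegral_freshTail_MM1Star (hμ₁ : 0 < μ₁) (hμ₂ : 0 < μ₂) :
    ∫⁻ a in Set.Ioi 0, freshTail μ₁ μ₂ noFreshMM1Star a = ENNReal.ofReal (1 / μ₁ + 1 / μ₂) := by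
  have h := setLIntegral_done_eq_sub (by positivity)
    ((lintegral_step₂ hμ₁ hμ₂ (g := ENNReal.ofReal) (by fun_prop) 0).trans
      (lintegral_expMeasure_ofReal hμ₂)) (setLIntegral_busy_step₂ hμ₁ hμ₂)
  have e : 1 / μ₂ - (μ₁ / (μ₁ + μ₂) ^ 2 + μ₁ / (μ₁ + μ₂) * (1 / μ₂)) = μ₂ / (μ₁ + μ₂) ^ 2 := by
    field_simp; ring
  rw [e] at h
  rw [freshFamily_noFreshMM1Star.lintegral_freshTail hμ₁ hμ₂ (refresh_nextPreempt hμ₁ hμ₂)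
    (by positivity) h]
  congr 1
  field_simp
  ring

lemma lintegral_freshTail_MM11 (hμ₁ : 0 < μ₁) (hμ₂ : 0 < μ₂) :
    ∫⁻ a in Set.Ioi 0, freshTail μ₁ μ₂ noFreshMM11 a =
      ENNReal.ofReal (2 * (1 / μ₁ + 1 / μ₂)) := by
  have h1 := setLIntegral_done_eq_sub (by positivity)
    ((lintegral_step₁ hμ₁ hμ₂ (g := ENNReal.ofReal) (by fun_prop) 0).trans
      (lintegral_expMeasure_ofReal hμ₁)) (setLIntegral_busy_step₁ hμ₁ hμ₂)
  have h2 := setLIntegral_done_eq_sub (by positivity)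
    ((lintegral_step₂ hμ₁ hμ₂ (g := ENNReal.ofReal) (by fun_prop) 1).trans
      (lintegral_expMeasure_ofReal hμ₂)) (setLIntegral_busy_step₂_next hμ₁ hμ₂)
  have e1 : 1 / μ₁ - μ₁ / (μ₁ + μ₂) ^ 2 =
      (μ₂ ^ 2 + 2 * μ₁ * μ₂) / (μ₁ * (μ₁ + μ₂) ^ 2) := by
    field_simp; ring
  have e2 : 1 / μ₂ - μ₁ / (μ₁ + μ₂) * (1 / μ₂) = 1 / (μ₁ + μ₂) := by
    field_simp; ring
  rw [e1] at h1
  rw [e2] at h2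
  have h : ∫⁻ z in {z | z.2 0 ≤ z.1 0}, ENNReal.ofReal (z.1 0 + z.2 1) ∂(pathMeasure μ₁ μ₂) =
      ENNReal.ofReal ((μ₂ ^ 2 + 2 * μ₁ * μ₂) / (μ₁ * (μ₁ + μ₂) ^ 2) + 1 / (μ₁ + μ₂)) := by
    rw [ENNReal.ofReal_add (by positivity) (by positivity), ← h1, ← h2,
      ← lintegral_add_left (by fun_prop)]
    refine lintegral_congr_ae (ae_restrict_of_ae ?_)
    filter_upwards [ae_nonnegPath hμ₁ hμ₂] with z hz
    exact ENNReal.ofReal_add (hz.1 0) (hz.2 1)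
  rw [freshFamily_noFreshMM11.lintegral_freshTail hμ₁ hμ₂ (refresh_nextBlock hμ₁ hμ₂)
    (by positivity) h]
  congr 1
  field_simp
  ring

end Constants

/-! ### Identification of the tails of the two ages -/

section Ages

lemma Start.age₂_nonneg (I : Start) : 0 ≤ I.age₂ := I.age₁_nonneg.trans I.age₁_le_age₂

lemma Start.monitorAge_nonneg (I : Start) : 0 ≤ I.monitorAge :=
  I.age₂_nonneg.trans I.age₂_le_monitorAge

lemma lineGenTime_le_arrivalTime (I : Start) (x : ℕ → ℝ) (k : ℕ) :
    lineGenTime I x k ≤ arrivalTime x k := by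
  cases k with
  | zero => simpa [lineGenTime, arrivalTime_zero] using I.age₂_nonneg
  | succ k => exact le_rfl

lemma genTime_le_arrivalTime (I : Start) {x : ℕ → ℝ} (hx : ∀ k, 0 ≤ x k) (k : ℕ) :
    genTime I x k ≤ arrivalTime x k := by
  match k with
  | 0 => simpa [genTime, arrivalTime_zero] using I.age₂_nonneg
  | 1 =>
    have := arrivalTime_nonneg hx 1
    have := I.age₁_nonneg
    simp only [genTime]
    linarith
  | k + 2 => exact arrivalTime_mono hx (Nat.le_succ _)

lemma lineGenTime_le_of_delivered (I : Start) {z : Path} (hz : NonnegPath z) {t : ℝ} (k : ℕ)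
    (hk : Enters I.state k ∧ arrivalTime z.1 k + z.2 k ≤ arrivalTime z.1 (k + 1) ∧
      arrivalTime z.1 k + z.2 k ≤ t) : lineGenTime I z.1 k ≤ t := by
  have := hz.2 k
  have := lineGenTime_le_arrivalTime I z.1 k
  linarith [hk.2.2]

lemma genTime_le_of_delivered (I : Start) {z : Path} (hz : NonnegPath z) {t : ℝ} (k : ℕ)
    (hk : Accepted I.state z.1 z.2 k ∧ arrivalTime z.1 k + z.2 k ≤ t) :
    genTime I z.1 k ≤ t := by
  have := hz.2 k
  have := genTime_le_arrivalTime I hz.1 k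
  linarith [hk.2]

lemma le_ageMM1Star_iff (I : Start) {z : Path} (hz : NonnegPath z) {t a : ℝ} (hat : a ≤ t) :
    a ≤ ageMM1Star I z.1 z.2 t ↔ z ∈ noFreshMM1Star (t - a) t := by
  have ha : a ≤ t + I.monitorAge := by linarith [I.monitorAge_nonneg]
  have hu : 0 ≤ t - a := sub_nonneg.2 hat
  rw [ageMM1Star, le_monitorAge_iff (lineGenTime_le_of_delivered I hz)]
  simp only [ha, true_and, noFreshMM1Star, Set.mem_ofPred_eq, not_exists]
  constructor
  · rintro h k ⟨h1, h2, h3⟩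
    cases k with
    | zero => rw [arrivalTime_zero] at h1; linarith
    | succ k => exact not_lt.2 (h (k + 1) ⟨trivial, h2, h3⟩) h1
  · rintro h k ⟨-, h2, h3⟩
    cases k with
    | zero =>
      have := I.age₂_nonneg
      simp only [lineGenTime]
      linarith
    | succ k => exact not_lt.1 fun h1 => h (k + 1) ⟨h1, h2, h3⟩

lemma ageMM1Star_mem (I : Start) {z : Path} (hz : NonnegPath z) {t : ℝ} (ht : 0 ≤ t) :
    0 ≤ ageMM1Star I z.1 z.2 t ∧ ageMM1Star I z.1 z.2 t ≤ t + I.monitorAge := by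
  refine ⟨?_, monitorAge_le (lineGenTime_le_of_delivered I hz)⟩
  rw [ageMM1Star, le_monitorAge_iff (lineGenTime_le_of_delivered I hz), sub_zero]
  exact ⟨add_nonneg ht I.monitorAge_nonneg, lineGenTime_le_of_delivered I hz⟩

lemma measurable_ageMM1Star (I : Start) (t : ℝ) :
    Measurable fun z : Path => ageMM1Star I z.1 z.2 t := by
  have hA := measurable_arrivalTime
  unfold ageMM1Star
  refine measurable_monitorAge (gen := fun z : Path => lineGenTime I z.1)
    (delivered := fun z k => Enters I.state k ∧ arrivalTime z.1 k + z.2 k ≤ arrivalTime z.1 (k + 1) ∧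
      arrivalTime z.1 k + z.2 k ≤ t) (fun k => ?_) (fun k => ?_) _ t
  · cases k with
    | zero => exact measurable_const
    | succ k => exact hA (k + 1)
  · have h : Measurable fun z : Path => arrivalTime z.1 k + z.2 k := (hA k).add (by fun_prop)
    exact (MeasurableSet.const _).inter
      ((measurableSet_le h (hA (k + 1))).inter (measurableSet_le h measurable_const))

/-- The updates generated before time `0` do not matter for ages up to `t`. -/
lemma le_ageMM11_iff (I : Start) {z : Path} (hz : NonnegPath z) {t a : ℝ} (hat : a ≤ t) :
    a ≤ ageMM11 I z.1 z.2 t ↔ ¬ ∃ k, t - a < arrivalTime z.1 (k + 1) ∧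
      freeTime I.state z.1 z.2 (k + 1) ≤ arrivalTime z.1 (k + 2) ∧
      arrivalTime z.1 (k + 2) + z.2 (k + 2) ≤ t := by
  have ha : a ≤ t + I.monitorAge := by linarith [I.monitorAge_nonneg]
  rw [ageMM11, le_monitorAge_iff (genTime_le_of_delivered I hz)]
  simp only [ha, true_and, not_exists]
  constructor
  · rintro h k ⟨h1, h2, h3⟩
    exact not_lt.2 (h (k + 2) ⟨h2, h3⟩) h1
  · rintro h k ⟨h2, h3⟩
    match k with
    | 0 =>
      have := I.age₂_nonneg
      simp only [genTime]
      linarith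
    | 1 =>
      have := I.age₁_nonneg
      simp only [genTime]
      linarith
    | k + 2 => exact not_lt.1 fun h1 => h k ⟨h1, h2, h3⟩

lemma le_ageMM11_busy_iff (I : Start) (hI : I.state = 1) {z : Path} (hz : NonnegPath z) {t a : ℝ}
    (hat : a ≤ t) : a ≤ ageMM11 I z.1 z.2 t ↔ z ∈ noFreshMM11 (t - a) t := by
  rw [le_ageMM11_iff I hz hat, hI]
  refine not_congr ?_
  rw [← Nat.or_exists_add_one (p := fun k => t - a < arrivalTime z.1 k ∧ _)]
  -- Index `0` in `noFreshMM11` is update `1`, taken there as generated at time `0` and in truth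
  -- generated at `-I.age₁`. Neither time exceeds `t - a ≥ 0`, so the discrepancy is harmless.
  have h0 : ¬ t - a < arrivalTime z.1 0 := by
    rw [arrivalTime_zero]; exact not_lt.2 (sub_nonneg.2 hat)
  simp only [h0, false_and, false_or]

lemma le_ageMM11_idle_iff (I : Start) (hI : I.state = 0) {z : Path} (hz : NonnegPath z) {t a : ℝ}
    (hat : a ≤ t) : a ≤ ageMM11 I z.1 z.2 t ↔
      nextPreempt z ∈ noFreshMM11 (t - a - z.1 0) (t - z.1 0) := by
  rw [le_ageMM11_iff I hz hat, hI]
  refine not_congr (exists_congr fun k => ?_)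
  rw [freeTime_idle_succ (hz.1 0), arrivalTime_succ z.1 k, arrivalTime_succ z.1 (k + 1)]
  simp only [nextPreempt]
  constructor <;> rintro ⟨h1, h2, h3⟩ <;> refine ⟨?_, ?_, ?_⟩ <;> linarith

lemma ageMM11_mem (I : Start) {z : Path} (hz : NonnegPath z) {t : ℝ} (ht : 0 ≤ t) :
    0 ≤ ageMM11 I z.1 z.2 t ∧ ageMM11 I z.1 z.2 t ≤ t + I.monitorAge := by
  refine ⟨?_, monitorAge_le (genTime_le_of_delivered I hz)⟩
  rw [ageMM11, le_monitorAge_iff (genTime_le_of_delivered I hz), sub_zero]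
  exact ⟨add_nonneg ht I.monitorAge_nonneg, genTime_le_of_delivered I hz⟩

lemma measurable_ageMM11 (I : Start) (t : ℝ) :
    Measurable fun z : Path => ageMM11 I z.1 z.2 t := by
  have hA := measurable_arrivalTime
  unfold ageMM11
  refine measurable_monitorAge (gen := fun z : Path => genTime I z.1)
    (delivered := fun z k => Accepted I.state z.1 z.2 k ∧ arrivalTime z.1 k + z.2 k ≤ t) (fun k => ?_) (fun k => ?_) _ t
  · match k with
    | 0 => exact measurable_const
    | 1 => exact measurable_const
    | k + 2 => exact hA (k + 1)
  · refine MeasurableSet.inter (?_ : MeasurableSet {z : Path | Accepted I.state z.1 z.2 k})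
      (measurableSet_le ((hA k).add (by fun_prop)) measurable_const)
    cases k with
    | zero => exact MeasurableSet.const _
    | succ k => exact measurableSet_le (measurable_freeTime I.state k) (hA (k + 1))

variable {μ₁ μ₂ : ℝ}

lemma isAverageAge_ageMM1Star (hμ₁ : 0 < μ₁) (hμ₂ : 0 < μ₂) (I : Start) :
    IsAverageAge (pathMeasure μ₁ μ₂) (fun t z => ageMM1Star I z.1 z.2 t) (1 / μ₁ + 1 / μ₂) := by
  have := isProbabilityMeasure_pathMeasure hμ₁ hμ₂
  refine isAverageAge_of_tail (a₀ := I.monitorAge) (by positivity)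
    (freshFamily_noFreshMM1Star.measurable_freshTail hμ₁ hμ₂)
    (fun t _ => (measurable_ageMM1Star I t).aemeasurable) (fun t ht => ?_) (fun t a ha hat => ?_)
    (lintegral_freshTail_MM1Star hμ₁ hμ₂)
  · filter_upwards [ae_nonnegPath hμ₁ hμ₂] with z hz using ageMM1Star_mem I hz ht
  · rw [← freshFamily_noFreshMM1Star.measure_eq_freshTail hμ₁ hμ₂ (refresh_nextPreempt hμ₁ hμ₂)
      (sub_nonneg.2 hat) a, sub_add_cancel]
    refine measure_congr ?_
    filter_upwards [ae_nonnegPath hμ₁ hμ₂] with z hz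
    exact propext (le_ageMM1Star_iff I hz hat)

lemma isAverageAge_ageMM11 (hμ₁ : 0 < μ₁) (hμ₂ : 0 < μ₂) (I : Start) :
    IsAverageAge (pathMeasure μ₁ μ₂) (fun t z => ageMM11 I z.1 z.2 t)
      (2 * (1 / μ₁ + 1 / μ₂)) := by
  have := isProbabilityMeasure_pathMeasure hμ₁ hμ₂
  have hN := freshFamily_noFreshMM11
  refine isAverageAge_of_tail (a₀ := I.monitorAge) (by positivity)
    (hN.measurable_freshTail hμ₁ hμ₂)
    (fun t _ => (measurable_ageMM11 I t).aemeasurable) (fun t ht => ?_) (fun t a ha hat => ?_)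
    (lintegral_freshTail_MM11 hμ₁ hμ₂)
  · filter_upwards [ae_nonnegPath hμ₁ hμ₂] with z hz using ageMM11_mem I hz ht
  · have hI : I.state = 0 ∨ I.state = 1 := by
      generalize I.state = q
      revert q; decide
    rcases hI with hI | hI
    · rw [← hN.measure_next_eq_freshTail hμ₁ hμ₂ (refresh_nextPreempt hμ₁ hμ₂)
        (refresh_nextBlock hμ₁ hμ₂) (sub_nonneg.2 hat) a, sub_add_cancel]
      refine measure_congr ?_
      filter_upwards [ae_nonnegPath hμ₁ hμ₂] with z hz
      exact propext (le_ageMM11_idle_iff I hI hz hat)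
    · rw [← hN.measure_eq_freshTail hμ₁ hμ₂ (refresh_nextBlock hμ₁ hμ₂) (sub_nonneg.2 hat) a,
        sub_add_cancel]
      refine measure_congr ?_
      filter_upwards [ae_nonnegPath hμ₁ hμ₂] with z hz
      exact propext (le_ageMM11_busy_iff I hI hz hat)

end Ages

end Tandem

/-! ### The discrete state and its stationary distribution -/

namespace Tandem

section Busy

variable {μ₁ μ₂ : ℝ}

lemma measurableSet_busyAt : MeasurableSet {p : ℝ × Path | p.2 ∈ busyAt p.1} := by
  have : {p : ℝ × Path | p.2 ∈ busyAt p.1} = ⋃ k, {p : ℝ × Path | arrivalTime p.2.1 k ≤ p.1 ∧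
      p.1 < freeTime 1 p.2.1 p.2.2 k} := by
    ext p; rw [Set.mem_iUnion]; rfl
  rw [this]
  exact MeasurableSet.iUnion fun k =>
    (measurableSet_le ((measurable_arrivalTime k).comp measurable_snd) (by fun_prop)).inter
      (measurableSet_lt (by fun_prop) ((measurable_freeTime 1 k).comp measurable_snd))

lemma measurableSet_busyAt_section (t : ℝ) : MeasurableSet (busyAt t) :=
  measurableSet_busyAt.preimage (f := fun z : Path => (t, z)) (by fun_prop)

/-- Before the first arrival, being busy means that the initial service still runs. Afterwards the
system has restarted busy on `nextBlock z`, whether or not that service had ended. -/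
lemma mem_busyAt_iff {z : Path} (hz : NonnegPath z) {t : ℝ} (ht : 0 ≤ t) :
    z ∈ busyAt t ↔ (t < z.1 0 ∧ t < z.2 0) ∨
      (z.1 0 ≤ t ∧ nextBlock z ∈ busyAt (t - z.1 0)) := by
  have hiff : z ∈ busyAt t ↔ t < z.2 0 ∨ nextBlock z ∈ busyAt (t - z.1 0) := by
    obtain ⟨x, s⟩ := z
    change (∃ k, _) ↔ _
    rw [← Nat.or_exists_add_one, arrivalTime_zero, freeTime_zero_busy]
    refine or_congr (by simp [ht]) (exists_congr fun k => ?_)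
    rw [arrivalTime_succ, freeTime_busy_succ]
    simp only [nextBlock]
    constructor <;> rintro ⟨h1, h2⟩ <;> constructor <;> linarith
  have hle : nextBlock z ∈ busyAt (t - z.1 0) → z.1 0 ≤ t := by
    rintro ⟨k, h, -⟩
    have := arrivalTime_nonneg (x := (nextBlock z).1) (fun i => hz.1 (i + 1)) k
    linarith
  have hgo : z.1 0 ≤ t → t < z.2 0 → nextBlock z ∈ busyAt (t - z.1 0) := by
    intro h1 h2
    refine ⟨0, ?_, ?_⟩
    · rw [arrivalTime_zero]; linarith
    · rw [freeTime_zero_busy]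
      simp only [nextBlock, seqCons]
      rw [if_neg (by linarith)]
      linarith
  rw [hiff]
  constructor
  · rintro (h | h)
    · rcases lt_or_ge t (z.1 0) with h' | h'
      · exact .inl ⟨h', h⟩
      · exact .inr ⟨h', hgo h' h⟩
    · exact .inr ⟨hle h, h⟩
  · rintro (h | h)
    · exact .inl h.2
    · exact .inr h.2

/-- Any refreshing map is allowed: `nextBlock` serves the busy start and `nextPreempt` the idle one,
whose first arrival is accepted. -/
lemma measure_next_busyAt (hμ₁ : 0 < μ₁) (hμ₂ : 0 < μ₂) {next : Path → Path}
    (hnext : Refresh μ₁ μ₂ next) (t : ℝ) :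
    pathMeasure μ₁ μ₂ {z | z.1 0 ≤ t ∧ next z ∈ busyAt (t - z.1 0)} =
      ∫⁻ y in Set.Iic t, pathMeasure μ₁ μ₂ (busyAt (t - y)) ∂(expMeasure μ₁) := by
  have hfst : MeasurableSet {p : ℝ × Path | p.1 ≤ t} :=
    measurableSet_le measurable_fst measurable_const
  have hS : MeasurableSet {p : ℝ × Path | p.1 ≤ t ∧ p.2 ∈ busyAt (t - p.1)} :=
    hfst.inter
      (measurableSet_busyAt.preimage (f := fun p : ℝ × Path => (t - p.1, p.2)) (by fun_prop))
  have h := hnext.lintegral_next hμ₁ hμ₂ (measurable_one.indicator hS)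
  have hS' : MeasurableSet {z | z.1 0 ≤ t ∧ next z ∈ busyAt (t - z.1 0)} :=
    hS.preimage (f := fun z : Path => (z.1 0, next z))
      (Measurable.prodMk (by fun_prop) hnext.measurable)
  rw [← lintegral_indicator_one hS', ← lintegral_indicator measurableSet_Iic]
  refine Eq.trans ?_ (h.trans ?_)
  · rfl
  · refine lintegral_congr fun y => ?_
    by_cases hy : y ≤ t
    · rw [Set.indicator_of_mem (Set.mem_Iic.2 hy),
        ← lintegral_indicator_one (measurableSet_busyAt_section _)]
      refine lintegral_congr fun z => ?_
      by_cases hz : z ∈ busyAt (t - y)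
      · rw [Set.indicator_of_mem hz, Set.indicator_of_mem (show (y, z) ∈ {p : ℝ × Path | p.1 ≤ t ∧ p.2 ∈ busyAt (t - p.1)} from ⟨hy, hz⟩)]
        rfl
      · rw [Set.indicator_of_notMem hz, Set.indicator_of_notMem fun h => hz h.2]
    · rw [Set.indicator_of_notMem (by simpa using hy)]
      refine (lintegral_congr fun z => ?_).trans lintegral_zero
      exact Set.indicator_of_notMem (fun h => hy h.1) _

lemma measure_lt_lt (hμ₁ : 0 < μ₁) (hμ₂ : 0 < μ₂) {t : ℝ} (ht : 0 ≤ t) :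
    pathMeasure μ₁ μ₂ {z | t < z.1 0 ∧ t < z.2 0} =
      ENNReal.ofReal (Real.exp (-((μ₁ + μ₂) * t))) := by
  have := isProbabilityMeasure_expMeasure hμ₁
  have := isProbabilityMeasure_expMeasure hμ₂
  have h : {z : Path | t < z.1 0 ∧ t < z.2 0} =
      ((fun x : ℕ → ℝ => x 0) ⁻¹' Set.Ioi t) ×ˢ ((fun x : ℕ → ℝ => x 0) ⁻¹' Set.Ioi t) := rfl
  rw [h, pathMeasure, Measure.prod_prod,
    (measurePreserving_eval_infinitePi (fun _ : ℕ => expMeasure μ₁) 0).measure_preimage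
      measurableSet_Ioi.nullMeasurableSet,
    (measurePreserving_eval_infinitePi (fun _ : ℕ => expMeasure μ₂) 0).measure_preimage
      measurableSet_Ioi.nullMeasurableSet, expMeasure_Ioi hμ₁ ht, expMeasure_Ioi hμ₂ ht,
    ← ENNReal.ofReal_mul (Real.exp_pos _).le, ← Real.exp_add]
  congr 2; ring

/-- `P(q(t) = 1 | q(0) = 1)`. -/
noncomputable def busyFromBusy (μ₁ μ₂ t : ℝ) : ℝ :=
  μ₁ / (μ₁ + μ₂) + μ₂ / (μ₁ + μ₂) * Real.exp (-((μ₁ + μ₂) * t))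

/-- `P(q(t) = 1 | q(0) = 0)`. -/
noncomputable def busyFromIdle (μ₁ μ₂ t : ℝ) : ℝ :=
  μ₁ / (μ₁ + μ₂) - μ₁ / (μ₁ + μ₂) * Real.exp (-((μ₁ + μ₂) * t))

lemma busyFromIdle_nonneg (hμ₁ : 0 < μ₁) (hμ₂ : 0 < μ₂) {t : ℝ} (ht : 0 ≤ t) :
    0 ≤ busyFromIdle μ₁ μ₂ t := by
  have h : Real.exp (-((μ₁ + μ₂) * t)) ≤ 1 := Real.exp_le_one_iff.2 (by nlinarith)
  have : busyFromIdle μ₁ μ₂ t = μ₁ / (μ₁ + μ₂) * (1 - Real.exp (-((μ₁ + μ₂) * t))) := by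
    unfold busyFromIdle; ring
  rw [this]
  exact mul_nonneg (by positivity) (sub_nonneg.2 h)

lemma lintegral_busyFromBusy (hμ₁ : 0 < μ₁) (hμ₂ : 0 < μ₂) {t : ℝ} (ht : 0 ≤ t) :
    ∫⁻ y in Set.Iic t, ENNReal.ofReal (busyFromBusy μ₁ μ₂ (t - y)) ∂(expMeasure μ₁) =
      ENNReal.ofReal (busyFromIdle μ₁ μ₂ t) := by
  have hl : 0 < μ₁ + μ₂ := by positivity
  rw [← lintegral_indicator measurableSet_Iic, lintegral_expMeasure]
  set f : ℝ → ℝ := fun y => μ₁ * Real.exp (-(μ₁ * y)) * busyFromBusy μ₁ μ₂ (t - y) with hf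
  have hfc : Continuous f := by unfold f busyFromBusy; fun_prop
  have h1 : ∫⁻ y in Set.Ioi 0, ENNReal.ofReal (μ₁ * Real.exp (-(μ₁ * y))) *
      (Set.Iic t).indicator (fun y => ENNReal.ofReal (busyFromBusy μ₁ μ₂ (t - y))) y =
      ∫⁻ y in Set.Ioc 0 t, ENNReal.ofReal (f y) := by
    rw [← Set.Ioi_inter_Iic, Set.inter_comm, ← Measure.restrict_restrict measurableSet_Iic,
      ← lintegral_indicator measurableSet_Iic]
    refine lintegral_congr fun y => ?_
    by_cases hy : y ≤ t
    · rw [Set.indicator_of_mem (Set.mem_Iic.2 hy), Set.indicator_of_mem (Set.mem_Iic.2 hy),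
        ← ENNReal.ofReal_mul (by positivity)]
    · rw [Set.indicator_of_notMem (by simpa using hy), Set.indicator_of_notMem (by simpa using hy),
        mul_zero]
  have h2 : ∫ y in (0)..t, f y = busyFromIdle μ₁ μ₂ t := by
    -- The integrand is a combination of `exp (-(μ₁ * y))` and, since `-(μ₁ * y) - (μ₁ + μ₂) * (t -
    -- y) = -((μ₁ + μ₂) * t) + μ₂ * y`, of `exp (μ₂ * y)`.
    have hd : ∀ y ∈ Set.uIcc 0 t, HasDerivAt (fun y => μ₁ / (μ₁ + μ₂) *
        (Real.exp (-((μ₁ + μ₂) * t)) * Real.exp (μ₂ * y) - Real.exp (-(μ₁ * y)))) (f y) y := by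
      intro y _
      have e1 : HasDerivAt (fun y => Real.exp (μ₂ * y)) (Real.exp (μ₂ * y) * μ₂) y := by
        simpa using ((hasDerivAt_id y).const_mul μ₂).exp
      have e2 : HasDerivAt (fun y => Real.exp (-(μ₁ * y))) (Real.exp (-(μ₁ * y)) * -μ₁) y := by
        simpa using ((hasDerivAt_id y).const_mul μ₁).neg.exp
      refine (((e1.const_mul (Real.exp (-((μ₁ + μ₂) * t)))).sub e2).const_mul
        (μ₁ / (μ₁ + μ₂))).congr_deriv ?_
      have e3 : Real.exp (-((μ₁ + μ₂) * (t - y))) =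
          Real.exp (-((μ₁ + μ₂) * t)) * Real.exp (μ₂ * y) * Real.exp (μ₁ * y) := by
        rw [← Real.exp_add, ← Real.exp_add]; congr 1; ring
      have e4 : Real.exp (-(μ₁ * y)) * Real.exp (μ₁ * y) = 1 := by
        rw [← Real.exp_add]; simp
      simp only [hf, busyFromBusy, e3]
      field_simp
      linear_combination -(μ₂ * Real.exp (-((μ₁ + μ₂) * t)) * Real.exp (μ₂ * y)) * e4
    rw [intervalIntegral.integral_eq_sub_of_hasDerivAt hd (hfc.intervalIntegrable _ _)]
    have e5 : Real.exp (-((μ₁ + μ₂) * t)) * Real.exp (μ₂ * t) = Real.exp (-(μ₁ * t)) := by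
      rw [← Real.exp_add]; congr 1; ring
    rw [e5]
    simp only [busyFromIdle, mul_zero, neg_zero, Real.exp_zero]
    ring
  rw [h1, ← h2, intervalIntegral.integral_of_le ht, ofReal_integral_eq_lintegral_ofReal]
  · exact (hfc.integrableOn_Icc (a := 0) (b := t)).mono_set Set.Ioc_subset_Icc_self
  · refine ae_of_all _ fun y => ?_
    simp only [hf, busyFromBusy, Pi.zero_apply]
    positivity

/-- The inhomogeneous term is the probability that neither the first arrival nor the end of the
initial service has occurred. The explicit function solves the same renewal equation. -/
lemma measure_busyAt (hμ₁ : 0 < μ₁) (hμ₂ : 0 < μ₂) {t : ℝ} (ht : 0 ≤ t) :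
    pathMeasure μ₁ μ₂ (busyAt t) = ENNReal.ofReal (busyFromBusy μ₁ μ₂ t) := by
  have := isProbabilityMeasure_pathMeasure hμ₁ hμ₂
  have hl : 0 < μ₁ + μ₂ := by positivity
  refine renewal_unique hμ₁ (φ := fun t => pathMeasure μ₁ μ₂ (busyAt t))
    (ψ := fun t => ENNReal.ofReal (busyFromBusy μ₁ μ₂ t))
    (g := fun t => ENNReal.ofReal (Real.exp (-((μ₁ + μ₂) * t))))
    (fun t _ => prob_le_one) (fun t ht => ?_) (fun t ht => ?_) (fun t ht => ?_) ht
  · rw [ENNReal.ofReal_le_one]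
    have h : Real.exp (-((μ₁ + μ₂) * t)) ≤ 1 := Real.exp_le_one_iff.2 (by nlinarith)
    unfold busyFromBusy
    rw [div_mul_eq_mul_div, ← add_div, div_le_one hl]
    nlinarith
  · have h1 : MeasurableSet {z : Path | t < z.1 0} :=
      measurableSet_lt measurable_const (by fun_prop)
    have h2 : MeasurableSet {z : Path | t < z.2 0} :=
      measurableSet_lt measurable_const (by fun_prop)
    have h12 : MeasurableSet {z : Path | t < z.1 0 ∧ t < z.2 0} := h1.inter h2
    rw [← measure_next_busyAt hμ₁ hμ₂ (refresh_nextBlock hμ₁ hμ₂), ← measure_lt_lt hμ₁ hμ₂ ht,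
      ← measure_union' _ h12]
    · refine measure_congr ?_
      filter_upwards [ae_nonnegPath hμ₁ hμ₂] with z hz
      exact propext (mem_busyAt_iff hz ht)
    · exact Set.disjoint_left.2 fun z h1 h2 => not_lt.2 h2.1 h1.1
  · rw [lintegral_busyFromBusy hμ₁ hμ₂ ht, ← ENNReal.ofReal_add (Real.exp_pos _).le
      (busyFromIdle_nonneg hμ₁ hμ₂ ht)]
    congr 1
    unfold busyFromBusy busyFromIdle
    field_simp
    ring

lemma measure_next_busyAt_eq (hμ₁ : 0 < μ₁) (hμ₂ : 0 < μ₂) {t : ℝ} (ht : 0 ≤ t) :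
    pathMeasure μ₁ μ₂ {z | z.1 0 ≤ t ∧ nextPreempt z ∈ busyAt (t - z.1 0)} =
      ENNReal.ofReal (busyFromIdle μ₁ μ₂ t) := by
  rw [measure_next_busyAt hμ₁ hμ₂ (refresh_nextPreempt hμ₁ hμ₂),
    ← lintegral_busyFromBusy hμ₁ hμ₂ ht]
  exact setLIntegral_congr_fun measurableSet_Iic fun y hy =>
    measure_busyAt hμ₁ hμ₂ (sub_nonneg.2 hy)

lemma stateMM11_busy_iff {z : Path} (hz : NonnegPath z) (t : ℝ) :
    stateMM11 1 z.1 z.2 t = 1 ↔ z ∈ busyAt t := by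
  unfold stateMM11
  rw [exists_accepted_iff hz.1]
  change _ ↔ ∃ k, arrivalTime z.1 k ≤ t ∧ t < freeTime 1 z.1 z.2 k
  split_ifs with h <;> simp [h]

lemma stateMM11_idle_iff {z : Path} (hz : NonnegPath z) {t : ℝ} (ht : 0 ≤ t) :
    stateMM11 0 z.1 z.2 t = 1 ↔ z.1 0 ≤ t ∧ nextPreempt z ∈ busyAt (t - z.1 0) := by
  have h : (∃ k, arrivalTime z.1 k ≤ t ∧ t < freeTime 0 z.1 z.2 k) ↔
      z.1 0 ≤ t ∧ nextPreempt z ∈ busyAt (t - z.1 0) := by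
    rw [← Nat.or_exists_add_one, freeTime_zero_idle]
    have h0 : ¬ t < 0 := not_lt.2 ht
    simp only [h0, and_false, false_or]
    constructor
    · rintro ⟨k, h1, h2⟩
      rw [arrivalTime_succ] at h1
      rw [freeTime_idle_succ (hz.1 0)] at h2
      have := arrivalTime_nonneg (x := fun i => z.1 (i + 1)) (fun i => hz.1 (i + 1)) k
      refine ⟨by linarith, k, ?_, ?_⟩ <;> simp only [nextPreempt] <;> linarith
    · rintro ⟨-, k, h1, h2⟩
      simp only [nextPreempt] at h1 h2
      refine ⟨k, ?_, ?_⟩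
      · rw [arrivalTime_succ]; linarith
      · rw [freeTime_idle_succ (hz.1 0)]; linarith
  unfold stateMM11
  rw [exists_accepted_iff hz.1, ← h]
  split_ifs with h' <;> simp [h']

section Stationary

variable {Ω : Type*} [MeasurableSpace Ω] {P : Measure Ω} {X S : ℕ → Ω → ℝ}

lemma ExpServices.ae_nonneg (hμ₁ : 0 < μ₁) (hμ₂ : 0 < μ₂) (h : ExpServices P μ₁ μ₂ X S) :
    ∀ᵐ ω ∂P, NonnegPath (fun n => X n ω, fun n => S n ω) := by
  have hlaw := h.hasLaw_path hμ₁ hμ₂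
  have := ae_nonnegPath hμ₁ hμ₂
  rw [← hlaw.map_eq] at this
  exact ae_of_ae_map hlaw.aemeasurable this

lemma stateMM11_ae_eq (hμ₁ : 0 < μ₁) (hμ₂ : 0 < μ₂) (h : ExpServices P μ₁ μ₂ X S) {t : ℝ}
    {i : ServerState} {A : Set Path}
    (hA : ∀ z, NonnegPath z → (stateMM11 i z.1 z.2 t = 1 ↔ z ∈ A)) :
    {ω | stateMM11 i (fun n => X n ω) (fun n => S n ω) t = 1} =ᵐ[P]
      (fun ω => ((fun n => X n ω, fun n => S n ω) : Path)) ⁻¹' A := by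
  filter_upwards [h.ae_nonneg hμ₁ hμ₂] with ω hω
  exact propext (hA _ hω)

lemma transProb_eq (hμ₁ : 0 < μ₁) (hμ₂ : 0 < μ₂) (h : ExpServices P μ₁ μ₂ X S) {t : ℝ}
    {i : ServerState} {A : Set Path} (hAm : MeasurableSet A)
    (hA : ∀ z, NonnegPath z → (stateMM11 i z.1 z.2 t = 1 ↔ z ∈ A)) :
    transProb P X S t i 1 = (pathMeasure μ₁ μ₂).real A := by
  rw [transProb, measureReal_congr (stateMM11_ae_eq hμ₁ hμ₂ h hA)]
  exact (h.hasLaw_path hμ₁ hμ₂).measureReal_eq hAm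

lemma transProb_zero_eq [IsProbabilityMeasure P] (hμ₁ : 0 < μ₁) (hμ₂ : 0 < μ₂)
    (h : ExpServices P μ₁ μ₂ X S) {t : ℝ}
    {i : ServerState} {A : Set Path} (hAm : MeasurableSet A)
    (hA : ∀ z, NonnegPath z → (stateMM11 i z.1 z.2 t = 1 ↔ z ∈ A)) :
    transProb P X S t i 0 = 1 - transProb P X S t i 1 := by
  have hnull : NullMeasurableSet {ω | stateMM11 i (fun n => X n ω) (fun n => S n ω) t = 1} P :=
    ((h.hasLaw_path hμ₁ hμ₂).aemeasurable.nullMeasurable hAm).congr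
      (stateMM11_ae_eq hμ₁ hμ₂ h hA).symm
  have hc : {ω | stateMM11 i (fun n => X n ω) (fun n => S n ω) t = 0} =
      {ω | stateMM11 i (fun n => X n ω) (fun n => S n ω) t = 1}ᶜ := by
    ext ω
    change stateMM11 i (fun n => X n ω) (fun n => S n ω) t = 0 ↔
      ¬ stateMM11 i (fun n => X n ω) (fun n => S n ω) t = 1
    generalize stateMM11 i (fun n => X n ω) (fun n => S n ω) t = q
    revert q; decide
  rw [transProb, hc, probReal_compl_eq_one_sub₀ hnull, transProb]

lemma measurableSet_next_busyAt (t : ℝ) :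
    MeasurableSet {z | z.1 0 ≤ t ∧ nextPreempt z ∈ busyAt (t - z.1 0)} := by
  have hfst : MeasurableSet {z : Path | z.1 0 ≤ t} :=
    measurableSet_le (by fun_prop) measurable_const
  exact hfst.inter
    (measurableSet_busyAt.preimage (f := fun z : Path => (t - z.1 0, nextPreempt z))
      (Measurable.prodMk (by fun_prop) measurable_nextPreempt))

lemma transProb_busy_busy (hμ₁ : 0 < μ₁) (hμ₂ : 0 < μ₂) (h : ExpServices P μ₁ μ₂ X S) {t : ℝ}
    (ht : 0 ≤ t) : transProb P X S t 1 1 = busyFromBusy μ₁ μ₂ t := by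
  rw [transProb_eq hμ₁ hμ₂ h (measurableSet_busyAt_section t)
    fun z hz => stateMM11_busy_iff hz t, measureReal_def, measure_busyAt hμ₁ hμ₂ ht,
    ENNReal.toReal_ofReal]
  unfold busyFromBusy
  positivity

lemma transProb_idle_busy (hμ₁ : 0 < μ₁) (hμ₂ : 0 < μ₂) (h : ExpServices P μ₁ μ₂ X S) {t : ℝ}
    (ht : 0 ≤ t) : transProb P X S t 0 1 = busyFromIdle μ₁ μ₂ t := by
  rw [transProb_eq hμ₁ hμ₂ h (measurableSet_next_busyAt t)
    fun z hz => stateMM11_idle_iff hz ht, measureReal_def, measure_next_busyAt_eq hμ₁ hμ₂ ht,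
    ENNReal.toReal_ofReal (busyFromIdle_nonneg hμ₁ hμ₂ ht)]

lemma transProb_zero [IsProbabilityMeasure P] (hμ₁ : 0 < μ₁) (hμ₂ : 0 < μ₂)
    (h : ExpServices P μ₁ μ₂ X S) {t : ℝ} (ht : 0 ≤ t) (i : ServerState) :
    transProb P X S t i 0 = 1 - transProb P X S t i 1 := by
  fin_cases i
  · exact transProb_zero_eq hμ₁ hμ₂ h (measurableSet_next_busyAt t)
      fun z hz => stateMM11_idle_iff hz ht
  · exact transProb_zero_eq hμ₁ hμ₂ h (measurableSet_busyAt_section t)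
      fun z hz => stateMM11_busy_iff hz t

lemma isStationary_iff [IsProbabilityMeasure P] (hμ₁ : 0 < μ₁) (hμ₂ : 0 < μ₂)
    (h : ExpServices P μ₁ μ₂ X S) (π : ServerState → ℝ) :
    IsStationary (transProb P X S) π ↔ π = ![μ₂ / (μ₁ + μ₂), μ₁ / (μ₁ + μ₂)] := by
  have hl : 0 < μ₁ + μ₂ := by positivity
  have e0 : μ₂ / (μ₁ + μ₂) = 1 - μ₁ / (μ₁ + μ₂) := by field_simp; ring
  constructor
  · rintro ⟨-, hsum, hst⟩
    rw [Fin.sum_univ_two] at hsum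
    -- Invariance at the single time `1` already determines `π`, because the deviation from
    -- equilibrium is multiplied there by `exp (-(μ₁ + μ₂)) < 1`.
    have h1 := hst 1 zero_le_one 1
    rw [Fin.sum_univ_two, transProb_idle_busy hμ₁ hμ₂ h zero_le_one,
      transProb_busy_busy hμ₁ hμ₂ h zero_le_one, busyFromIdle, busyFromBusy, mul_one] at h1
    have hE : Real.exp (-(μ₁ + μ₂)) < 1 := Real.exp_lt_one_iff.2 (by linarith)
    have h2 : (π 1 - μ₁ / (μ₁ + μ₂)) * (1 - Real.exp (-(μ₁ + μ₂))) = 0 := by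
      rw [e0] at h1
      have : π 0 = 1 - π 1 := by linarith
      rw [this] at h1
      linear_combination -h1
    have h3 : π 1 = μ₁ / (μ₁ + μ₂) := by
      rcases mul_eq_zero.1 h2 with h' | h' <;> linarith
    ext i
    fin_cases i
    · simp only [Fin.zero_eta, Matrix.cons_val_zero, e0]; linarith
    · simpa using h3
  · rintro rfl
    refine ⟨?_, ?_, ?_⟩
    · intro i
      fin_cases i <;> simp <;> positivity
    · rw [Fin.sum_univ_two]; simp [e0]
    · intro t ht j
      rw [Fin.sum_univ_two]
      have h1 : μ₂ / (μ₁ + μ₂) * transProb P X S t 0 1 +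
          μ₁ / (μ₁ + μ₂) * transProb P X S t 1 1 = μ₁ / (μ₁ + μ₂) := by
        rw [transProb_idle_busy hμ₁ hμ₂ h ht, transProb_busy_busy hμ₁ hμ₂ h ht, busyFromIdle,
          busyFromBusy]
        field_simp
        ring
      fin_cases j
      · simp only [Fin.zero_eta, Matrix.cons_val_zero, Matrix.cons_val_one,
          transProb_zero hμ₁ hμ₂ h ht]
        linarith
      · simpa using h1

end Stationary

end Busy

end Tandem

theorem mainTheorem6 {Ω : Type*} [MeasurableSpace Ω] (P : Measure Ω) [IsProbabilityMeasure P]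
    (μ₁ μ₂ ρ α : ℝ) (hμ₁ : 0 < μ₁) (hμ₂ : 0 < μ₂) (hρ : ρ = μ₁ / μ₂)
    (X S : ℕ → Ω → ℝ) (hXS : Tandem.ExpServices P μ₁ μ₂ X S) :
    (∀ I : Tandem.Start, ∃ Δ₁₁ Δstar : ℝ,
      Tandem.IsAverageAge P
        (fun t ω => Tandem.ageMM11 I (fun n => X n ω) (fun n => S n ω) t) Δ₁₁ ∧
      Tandem.IsAverageAge P
        (fun t ω => Tandem.ageMM1Star I (fun n => X n ω) (fun n => S n ω) t) Δstar ∧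
      Δ₁₁ = 2 / μ₂ * (1 + 1 / ρ) ∧
      Δ₁₁ = 2 * Δstar) ∧
    ∃ π : Tandem.ServerState → ℝ,
      (∀ π', Tandem.IsStationary (Tandem.transProb P X S) π' ↔ π' = π) ∧
      Tandem.activity α ρ π = ρ ^ α + ρ / (1 + ρ) := by
  have hlaw := hXS.hasLaw_path hμ₁ hμ₂
  -- The averages enter as `2 * (1 / μ₁ + 1 / μ₂)` and `1 / μ₁ + 1 / μ₂`, so their ratio holds by
  -- `rfl`.
  refine ⟨fun I => ⟨_, _, (Tandem.isAverageAge_ageMM11 hμ₁ hμ₂ I).of_hasLaw hlaw,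
    (Tandem.isAverageAge_ageMM1Star hμ₁ hμ₂ I).of_hasLaw hlaw, ?_, rfl⟩,
    _, Tandem.isStationary_iff hμ₁ hμ₂ hXS, ?_⟩
  · subst hρ
    field_simp
    ring
  · have hl : 0 < μ₁ + μ₂ := by positivity
    subst hρ
    simp only [Tandem.activity, Tandem.numStep₁, Tandem.numStep₂, Fin.sum_univ_two]
    simp
    field_simp
    ring
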